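/- Let $K$ be a compact Hausdorff space and $\mathrm{C}(K)$ the Banach lattice of continuous complex-valued functions on $K$. A Markov operator on $\mathrm{C}(K)$ is a bounded linear operator $T$ which is positive ($Tf\ge 0$ whenever $f\ge 0$) and satisfies $T\mathbb{1}=\mathbb{1}$. Let $\mathcal{S}$ be a semigroup (under composition) of Markov operators on $\mathrm{C}(K)$ which is right amenable for the strong operator topology, i.e. there is a positive functional $m\in \mathrm{C}_{\mathrm b}(\mathcal{S})'$ with $m(\mathbb{1})=1$ and $m(R_T\varphi)=m(\varphi)$ for all $T\in\mathcal{S}$, $\varphi\in\mathrm{C}_{\mathrm b}(\mathcal{S})$, where $(R_T\varphi)(U)=\varphi(UT)$. Write $\mathrm{fix}(\mathcal{S})=\{f\in \mathrm{C}(K): Tf=f \text{ for all } T\in\mathcal{S}\}$. A regular Borel probability measure $\mu$ on $K$ is invariant if $\int Tf\,d\mu=\int f\,d\mu$ for all $T\in\mathcal{S}$, $f\in\mathrm{C}(K)$; then each $T\in\mathcal{S}$ extends uniquely to a bounded operator $T_\mu$ on $\mathrm{L}^1(K,\mu)$, and $\mu$ is called ergodic if $\{h\in \mathrm{L}^1(K,\mu):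 T_\mu h=h \text{ for all } T\in\mathcal{S}\}$ is one-dimensional. Let $I_\mu=\{f\in\mathrm{C}(K):\int|f|\,d\mu=0\}$. An $\mathcal{S}$-ideal is a closed proper ideal $I$ of $\mathrm{C}(K)$ with $TI\subset I$ for all $T\in\mathcal{S}$; the primitive spectrum $\mathrm{Prim}(\mathcal{S})$ is the set of all $\mathcal{S}$-ideals of the form $I_\mu$ with $\mu$ ergodic. It carries the hull-kernel topology, in which the closure of $A\subset \mathrm{Prim}(\mathcal{S})$ is $\{p\in \mathrm{Prim}(\mathcal{S}): \bigcap_{q\in A}q\subset p\}$ (with $\bigcap_{q\in\emptyset}q=\mathrm{C}(K)$). Suppose that $\mathcal{S}$ is radical free, i.e. $\bigcap_{p\in \mathrm{Prim}(\mathcal{S})}p=\{0\}$ (equivalently, the union of the supports of all ergodic measures is dense in $K$). Then $\mathrm{fix}(\mathcal{S})$ is a Banach sublattice of $\mathrm{C}(K)$, i.e. a closed linear subspace containing $\overline f$ and $|f|$ for each of its elements $f$. Moreover, $\mathrm{Prim}(\mathcal{S})$ is quasi-compact (so that $\mathrm{C}(\mathrm{Prim}(\mathcal{S}))$, the space of continuous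 complex-valued functions on $\mathrm{Prim}(\mathcal{S})$, is a Banach lattice under the supremum norm), the formula $$\hat f(I_\mu)=\int_K f\,d\mu \qquad (\mu \text{ ergodic})$$ gives, for each $f\in\mathrm{fix}(\mathcal{S})$, a well-defined continuous function $\hat f$ on $\mathrm{Prim}(\mathcal{S})$, and the map $f\mapsto\hat f$ is an isometric Markov lattice isomorphism of $\mathrm{fix}(\mathcal{S})$ onto $\mathrm{C}(\mathrm{Prim}(\mathcal{S}))$: it is a linear isometric bijection, it is positive with $\hat{\mathbb{1}}=\mathbb{1}$, and $\widehat{|f|}=|\hat f|$ for all $f\in\mathrm{fix}(\mathcal{S})$. -/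

import Mathlib

open MeasureTheory Set Filter Topology
open scoped ComplexOrder ENNReal BoundedContinuousFunction

noncomputable section

set_option linter.unusedSectionVars false

/-- The modulus `|f|` of a complex-valued continuous function. -/
def modulus {X : Type*} [TopologicalSpace X] (f : C(X, ℂ)) : C(X, ℂ) where
  toFun x := ((‖f x‖ : ℝ) : ℂ)
  continuous_toFun := by fun_prop

/-- A linear subspace of the complex Banach lattice `C(X)` is a Banach sublattice if it is closed,
self-conjugate and contains the modulus of each of its elements. -/
structure IsBanachSublattice {X : Type*} [TopologicalSpace X] [CompactSpace X]
    (F : Submodule ℂ C(X, ℂ)) : Prop where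
  isClosed : IsClosed (F : Set C(X, ℂ))
  conj_mem : ∀ f ∈ F, star f ∈ F
  modulus_mem : ∀ f ∈ F, modulus f ∈ F

/-- Markov operators on `C(K)`: positive operators that fix the constant function one. -/
structure IsMarkov {K : Type*} [TopologicalSpace K] [CompactSpace K]
    (T : C(K, ℂ) →L[ℂ] C(K, ℂ)) : Prop where
  nonneg : ∀ f : C(K, ℂ), (∀ x, 0 ≤ f x) → ∀ x, 0 ≤ T f x
  map_one : T 1 = 1

/-- A semigroup (under composition) of Markov operators on `C(K)`. -/
structure MarkovSemigroup (K : Type*) [TopologicalSpace K] [CompactSpace K] where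
  ops : Subsemigroup (C(K, ℂ) →L[ℂ] C(K, ℂ))
  markov : ∀ T ∈ ops, IsMarkov T

section Kernel

variable {K : Type*} [TopologicalSpace K] [CompactSpace K] [MeasurableSpace K] [BorelSpace K]

theorem integrable_cont (μ : ProbabilityMeasure K) {E : Type*} [NormedAddCommGroup E]
    (f : C(K, E)) : Integrable f (μ : Measure K) :=
  f.continuous.integrable_of_hasCompactSupport (HasCompactSupport.of_compactSpace _)

/-- The absolute kernel `I_μ = {f | ⟨|f|, μ⟩ = 0}`, a (ring) ideal of `C(K)`. -/
def absKernel (μ : ProbabilityMeasure K) : Ideal C(K, ℂ) where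
  carrier := {f | ∫ x, ‖f x‖ ∂(μ : Measure K) = 0}
  zero_mem' := by simp
  add_mem' := by
    intro f g hf hg
    simp only [Set.mem_ofPred_eq] at hf hg ⊢
    refine le_antisymm ?_ (integral_nonneg fun x => norm_nonneg _)
    have h : ∫ x, (‖f x‖ + ‖g x‖) ∂(μ : Measure K) = 0 := by
      rw [integral_add (integrable_cont μ f).norm (integrable_cont μ g).norm, hf, hg, add_zero]
    rw [← h]
    exact integral_mono (integrable_cont μ (f + g)).norm
      ((integrable_cont μ f).norm.add (integrable_cont μ g).norm) fun x => norm_add_le _ _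
  smul_mem' := by
    intro c f hf
    simp only [Set.mem_ofPred_eq] at hf ⊢
    refine le_antisymm ?_ (integral_nonneg fun x => norm_nonneg _)
    have h : ∫ x, ‖c‖ * ‖f x‖ ∂(μ : Measure K) = 0 := by rw [integral_const_mul, hf, mul_zero]
    rw [← h]
    refine integral_mono (integrable_cont μ (c • f)).norm
      ((integrable_cont μ f).norm.const_mul _) fun x => ?_
    simp only [smul_eq_mul, ContinuousMap.mul_apply, norm_mul]
    exact mul_le_mul_of_nonneg_right (c.norm_coe_le_norm x) (norm_nonneg _)

end Kernel

namespace MarkovSemigroup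

section Amenable

variable {K : Type*} [TopologicalSpace K] [CompactSpace K]

/-- The underlying set of the semigroup, to be endowed with the strong operator topology. -/
def Elem (S : MarkovSemigroup K) : Type _ := S.ops

instance (S : MarkovSemigroup K) : Mul S.Elem := inferInstanceAs (Mul S.ops)

/-- The strong operator topology: the topology of pointwise (norm) convergence on `C(K)`. -/
instance (S : MarkovSemigroup K) : TopologicalSpace S.Elem :=
  TopologicalSpace.induced (fun (T : S.Elem) (f : C(K, ℂ)) => T.1 f) Pi.topologicalSpace

theorem continuous_mul_right (S : MarkovSemigroup K) (T : S.Elem) :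
    Continuous fun U : S.Elem => U * T := by
  refine continuous_induced_rng.2 (continuous_pi fun f => ?_)
  exact (continuous_apply (T.1 f)).comp continuous_induced_dom

/-- Right translation `(R_T φ)(U) = φ(U T)` on `C_b(S)`. -/
def rightTranslate (S : MarkovSemigroup K) (T : S.Elem) (φ : S.Elem →ᵇ ℂ) : S.Elem →ᵇ ℂ :=
  φ.compContinuous ⟨fun U => U * T, S.continuous_mul_right T⟩

/-- Right amenability with respect to the strong operator topology: there is a right invariant
mean on `C_b(S)`. -/
def RightAmenable (S : MarkovSemigroup K) : Prop :=
  ∃ m : (S.Elem →ᵇ ℂ) →L[ℂ] ℂ,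
    (∀ φ : S.Elem →ᵇ ℂ, (∀ T, 0 ≤ φ T) → 0 ≤ m φ) ∧
    m (BoundedContinuousFunction.const S.Elem 1) = 1 ∧
    ∀ (T : S.Elem) (φ : S.Elem →ᵇ ℂ), m (S.rightTranslate T φ) = m φ

/-- The fixed space of the semigroup in `C(K)`. -/
def fix (S : MarkovSemigroup K) : Submodule ℂ C(K, ℂ) where
  carrier := {f | ∀ T ∈ S.ops, T f = f}
  zero_mem' := by intro T _; simp
  add_mem' := by intro f g hf hg T hT; simp [hf T hT, hg T hT]
  smul_mem' := by intro c f hf T hT; simp [hf T hT]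

theorem one_mem_fix (S : MarkovSemigroup K) : (1 : C(K, ℂ)) ∈ S.fix :=
  fun T hT => (S.markov T hT).map_one

/-- An `S`-ideal is a closed proper ideal of `C(K)` that is invariant under `S`. -/
structure IsSIdeal (S : MarkovSemigroup K) (I : Ideal C(K, ℂ)) : Prop where
  isClosed : IsClosed (I : Set C(K, ℂ))
  proper : I ≠ ⊤
  invariant : ∀ T ∈ S.ops, ∀ f ∈ I, T f ∈ I

end Amenable

section Ergodic

variable {K : Type*} [TopologicalSpace K] [CompactSpace K] [T2Space K] [MeasurableSpace K]
  [BorelSpace K]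

/-- The set `P_S(K)` of invariant regular Borel probability measures. -/
def invariantMeasures (S : MarkovSemigroup K) : Set (ProbabilityMeasure K) :=
  {μ | (μ : Measure K).Regular ∧
    ∀ T ∈ S.ops, ∀ f : C(K, ℂ), ∫ x, T f x ∂(μ : Measure K) = ∫ x, f x ∂(μ : Measure K)}

/-- The canonical map `C(K) → L¹(K, μ)`. -/
def toL1 (μ : ProbabilityMeasure K) : C(K, ℂ) →L[ℂ] Lp ℂ 1 (μ : Measure K) :=
  ContinuousMap.toLp 1 (μ : Measure K) ℂ

/-- The operator `T_μ` induced by `T` on `L¹(K, μ)`, i.e. the continuous extension of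
`f ↦ T f` along `C(K) → L¹(K, μ)`. -/
def inducedL1 (T : C(K, ℂ) →L[ℂ] C(K, ℂ)) (μ : ProbabilityMeasure K) :
    Lp ℂ 1 (μ : Measure K) →L[ℂ] Lp ℂ 1 (μ : Measure K) :=
  ((toL1 μ).toLinearMap ∘ₗ T.toLinearMap).extendOfNorm (toL1 μ).toLinearMap

/-- The fixed space of the induced semigroup on `L¹(K, μ)`. -/
def fixL1 (S : MarkovSemigroup K) (μ : ProbabilityMeasure K) :
    Submodule ℂ (Lp ℂ 1 (μ : Measure K)) where
  carrier := {h | ∀ T ∈ S.ops, inducedL1 T μ h = h}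
  zero_mem' := by intro T _; simp
  add_mem' := by intro f g hf hg T hT; simp [hf T hT, hg T hT]
  smul_mem' := by intro c f hf T hT; simp [hf T hT]

/-- An invariant probability measure is ergodic if the fixed space of the induced semigroup
on `L¹(K, μ)` is one-dimensional. -/
def IsErgodic (S : MarkovSemigroup K) (μ : ProbabilityMeasure K) : Prop :=
  μ ∈ S.invariantMeasures ∧ Module.finrank ℂ (S.fixL1 μ) = 1

/-- The primitive spectrum: the set of all `S`-ideals which are absolute kernels of ergodic
measures. -/
def Prim (S : MarkovSemigroup K) : Set (Ideal C(K, ℂ)) :=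
  {p | S.IsSIdeal p ∧ ∃ μ, S.IsErgodic μ ∧ p = absKernel μ}

/-- The kernel of a set of primitive ideals (the whole of `C(K)` for the empty set). -/
def ker (S : MarkovSemigroup K) (A : Set S.Prim) : Ideal C(K, ℂ) :=
  ⨅ p ∈ A, (p : Ideal C(K, ℂ))

/-- The hull of a subset of `C(K)`. -/
def hull (S : MarkovSemigroup K) (I : Set C(K, ℂ)) : Set S.Prim :=
  {p | I ⊆ ((p : Ideal C(K, ℂ)) : Set C(K, ℂ))}

/-- The `S`-radical of a subset of `C(K)`. -/
def rad (S : MarkovSemigroup K) (I : Set C(K, ℂ)) : Ideal C(K, ℂ) := S.ker (S.hull I)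

/-- `S` is radical free if the radical of the zero ideal is the zero ideal. -/
def RadicalFree (S : MarkovSemigroup K) : Prop :=
  S.rad ((⊥ : Ideal C(K, ℂ)) : Set C(K, ℂ)) = ⊥

/-! Facts showing that `A ↦ hull (ker A)` is a Kuratowski closure operator. -/

theorem norm_apply_le {T : C(K, ℂ) →L[ℂ] C(K, ℂ)} (hT : IsMarkov T) (f : C(K, ℂ)) (x : K) :
    ((‖T f x‖ : ℝ) : ℂ) ≤ T (modulus f) x := by
  obtain ⟨c, hc, hcz⟩ : ∃ c : ℂ, ‖c‖ = 1 ∧ c * T f x = (‖T f x‖ : ℝ) := by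
    by_cases hz : T f x = 0
    · exact ⟨1, by simp, by simp [hz]⟩
    · have hn : (‖T f x‖ : ℂ) ≠ 0 := by simpa using hz
      refine ⟨star (T f x) / ‖T f x‖, by simp [hz], ?_⟩
      rw [div_mul_eq_mul_div, Complex.star_def, Complex.conj_mul', sq, mul_div_assoc, div_self hn,
        mul_one]
  let u : C(K, ℂ) := ⟨fun y => (((c * f y).re : ℝ) : ℂ), by fun_prop⟩
  let v : C(K, ℂ) := ⟨fun y => (((c * f y).im : ℝ) : ℂ), by fun_prop⟩
  have hnorm : ∀ y, ‖c * f y‖ = ‖f y‖ := fun y => by rw [norm_mul, hc, one_mul]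
  have key : ∀ w : C(K, ℂ), (∀ y, 0 ≤ (modulus f - w) y) →
      0 ≤ T (modulus f) x - T w x := by
    intro w hw
    simpa using hT.nonneg _ hw x
  have hm : 0 ≤ T (modulus f) x := by
    refine hT.nonneg _ (fun y => ?_) x
    simp [modulus]
  have hu := key u fun y => by
    simp only [ContinuousMap.sub_apply, modulus, u, ContinuousMap.coe_mk, ← Complex.ofReal_sub,
      Complex.zero_le_real, sub_nonneg]
    exact (Complex.re_le_norm _).trans (hnorm y).le
  have hv := key v fun y => by
    simp only [ContinuousMap.sub_apply, modulus, v, ContinuousMap.coe_mk, ← Complex.ofReal_sub,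
      Complex.zero_le_real, sub_nonneg]
    exact (Complex.im_le_norm _).trans (hnorm y).le
  have hsum : c • f = u + Complex.I • v := by
    ext y
    simp only [ContinuousMap.smul_apply, smul_eq_mul, ContinuousMap.add_apply, u, v,
      ContinuousMap.coe_mk]
    rw [mul_comm Complex.I, Complex.re_add_im]
  have hT' : ((‖T f x‖ : ℝ) : ℂ) = T u x + Complex.I * T v x := by
    rw [← hcz]
    have := congrArg (fun g => T g x) hsum
    simpa using this
  rw [Complex.le_def] at hm hu hv
  have h1 := congrArg Complex.re hT'
  simp at h1 hm hu hv
  rw [Complex.le_def]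
  constructor
  · simp; linarith
  · simp; linarith

theorem norm_toL1 (μ : ProbabilityMeasure K) (f : C(K, ℂ)) :
    ‖toL1 μ f‖ = ∫ x, ‖f x‖ ∂(μ : Measure K) := by
  rw [L1.norm_eq_integral_norm]
  refine integral_congr_ae ?_
  filter_upwards [ContinuousMap.coeFn_toLp (p := 1) (𝕜 := ℂ) (μ : Measure K) f] with x hx
  rw [toL1, hx]

theorem norm_toL1_map_le {S : MarkovSemigroup K} {μ : ProbabilityMeasure K}
    (hμ : μ ∈ S.invariantMeasures) {T : C(K, ℂ) →L[ℂ] C(K, ℂ)} (hT : T ∈ S.ops) (f : C(K, ℂ)) :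
    ‖toL1 μ (T f)‖ ≤ ‖toL1 μ f‖ := by
  rw [norm_toL1, norm_toL1]
  have h := congrArg Complex.re (hμ.2 T hT (modulus f))
  have h1 : (∫ x, modulus f x ∂(μ : Measure K)).re = ∫ x, ‖f x‖ ∂(μ : Measure K) := by
    simp only [modulus, ContinuousMap.coe_mk]
    rw [integral_complex_ofReal, Complex.ofReal_re]
  have h2 : (∫ x, T (modulus f) x ∂(μ : Measure K)).re
      = ∫ x, (T (modulus f) x).re ∂(μ : Measure K) :=
    (integral_re (𝕜 := ℂ) (integrable_cont μ (T (modulus f)))).symm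
  rw [← h1, ← h, h2]
  refine integral_mono (integrable_cont μ (T f)).norm (integrable_cont μ (T (modulus f))).re
    fun x => ?_
  have := (Complex.le_def.1 (norm_apply_le (S.markov T hT) f x)).1
  simpa using this

theorem denseRange_toL1 {S : MarkovSemigroup K} {μ : ProbabilityMeasure K}
    (hμ : μ ∈ S.invariantMeasures) : DenseRange (toL1 μ) := by
  have := hμ.1
  exact ContinuousMap.toLp_denseRange ℂ (μ : Measure K) ℂ (by simp)

theorem inducedL1_toL1 {S : MarkovSemigroup K} {μ : ProbabilityMeasure K}
    (hμ : μ ∈ S.invariantMeasures) {T : C(K, ℂ) →L[ℂ] C(K, ℂ)} (hT : T ∈ S.ops) (f : C(K, ℂ)) :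
    inducedL1 T μ (toL1 μ f) = toL1 μ (T f) :=
  LinearMap.extendOfNorm_eq (f := (toL1 μ).toLinearMap ∘ₗ T.toLinearMap)
    (e := (toL1 μ).toLinearMap) (denseRange_toL1 hμ)
    ⟨1, fun g => by simpa using norm_toL1_map_le hμ hT g⟩ f

theorem exists_bump {μ : ProbabilityMeasure K} [(μ : Measure K).Regular] {U : Set K}
    (hU : IsOpen U) {r : ℝ} (hr : r < (μ : Measure K).real U) :
    ∃ f : C(K, ℂ), (∀ x, 0 ≤ f x ∧ f x ≤ 1) ∧ (∀ x ∉ U, f x = 0) ∧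
      r < (∫ x, f x ∂(μ : Measure K)).re := by
  rcases lt_or_ge r 0 with h0 | h0
  · exact ⟨0, by simp, by simp, by simpa using h0⟩
  have hr' : ENNReal.ofReal r < (μ : Measure K) U := by
    rw [Measure.real] at hr
    exact (ENNReal.ofReal_lt_iff_lt_toReal h0 (measure_ne_top _ _)).2 hr
  obtain ⟨C, hCU, hC, hrC⟩ := hU.exists_lt_isCompact hr'
  obtain ⟨g, hg1, hg0, -, hg01⟩ := exists_continuous_one_zero_of_isCompact hC hU.isClosed_compl
    (disjoint_compl_right_iff_subset.2 hCU)
  have hrC' : r < (μ : Measure K).real C :=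
    (ENNReal.ofReal_lt_iff_lt_toReal h0 (measure_ne_top _ _)).1 hrC
  refine ⟨⟨fun x => ((g x : ℝ) : ℂ), by fun_prop⟩, fun x => ⟨?_, ?_⟩, fun x hx => ?_, ?_⟩
  · simpa using (hg01 x).1
  · simpa using Complex.real_le_real.2 (hg01 x).2
  · have := hg0 hx
    simp only [Pi.zero_apply] at this
    simp [this]
  · simp only [ContinuousMap.coe_mk]
    rw [integral_complex_ofReal, Complex.ofReal_re]
    refine hrC'.trans_le ?_
    have hi : ∫ x, C.indicator (fun _ => (1 : ℝ)) x ∂(μ : Measure K) = (μ : Measure K).real C := by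
      simpa using integral_indicator_const (μ := (μ : Measure K)) (1 : ℝ) hC.measurableSet
    rw [← hi]
    refine integral_mono ((integrable_const _).indicator hC.measurableSet)
      (integrable_cont μ g) fun x => ?_
    by_cases hx : x ∈ C
    · have := hg1 hx
      simp only [Pi.one_apply] at this
      simp [hx, this]
    · simpa [hx] using (hg01 x).1

theorem norm_indicator_sub {μ : ProbabilityMeasure K} {U : Set K} (hU : IsOpen U) (g : C(K, ℂ))
    (h01 : ∀ x, 0 ≤ g x ∧ g x ≤ 1) (h0 : ∀ x ∉ U, g x = 0) :
    ‖indicatorConstLp 1 hU.measurableSet (measure_ne_top (μ : Measure K) U) (1 : ℂ) - toL1 μ g‖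
      = (μ : Measure K).real U - (∫ x, g x ∂(μ : Measure K)).re := by
  have hi : ∫ x, U.indicator (fun _ => (1 : ℝ)) x ∂(μ : Measure K) = (μ : Measure K).real U := by
    simpa using integral_indicator_const (μ := (μ : Measure K)) (1 : ℝ) hU.measurableSet
  have h2 : (∫ x, g x ∂(μ : Measure K)).re = ∫ x, (g x).re ∂(μ : Measure K) :=
    (integral_re (𝕜 := ℂ) (integrable_cont μ g)).symm
  have h3 : ∫ x, (U.indicator (fun _ => (1 : ℝ)) x - (g x).re) ∂(μ : Measure K)
      = (μ : Measure K).real U - ∫ x, (g x).re ∂(μ : Measure K) := by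
    rw [← hi]
    exact integral_sub ((integrable_const _).indicator hU.measurableSet) (integrable_cont μ g).re
  rw [h2, ← h3, L1.norm_eq_integral_norm]
  refine integral_congr_ae ?_
  filter_upwards [ContinuousMap.coeFn_toLp (p := 1) (𝕜 := ℂ) (μ : Measure K) g,
    Lp.coeFn_sub (indicatorConstLp 1 hU.measurableSet (measure_ne_top (μ : Measure K) U) (1 : ℂ))
      (toL1 μ g),
    indicatorConstLp_coeFn (p := 1) (hs := hU.measurableSet)
      (hμs := measure_ne_top (μ : Measure K) U) (c := (1 : ℂ))] with x hx1 hx2 hx3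
  rw [hx2, Pi.sub_apply, hx3, toL1, hx1]
  have him : (g x).im = 0 := by simpa using ((Complex.le_def.1 (h01 x).1).2).symm
  have hgx : g x = (((g x).re : ℝ) : ℂ) := Complex.ext (by simp) (by simp [him])
  have hre := (Complex.le_def.1 (h01 x).2).1
  by_cases hx : x ∈ U
  · simp only [hx, indicator_of_mem]
    rw [hgx, ← Complex.ofReal_one, ← Complex.ofReal_sub, Complex.norm_real, Complex.ofReal_re,
      Real.norm_of_nonneg (by simpa using hre)]
  · simp [hx, h0 x hx]

theorem mem_of_eq_zero {I : Ideal C(K, ℂ)} (hI : IsClosed (I : Set C(K, ℂ))) {f : C(K, ℂ)}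
    (hf : ∀ x ∉ ContinuousMap.setOfIdeal I, f x = 0) : f ∈ I := by
  rw [← ContinuousMap.idealOfSet_ofIdeal_isClosed hI, ContinuousMap.mem_idealOfSet]
  exact fun x hx => hf x hx

theorem full_of_not_le {S : MarkovSemigroup K} {μ : ProbabilityMeasure K} (hμ : S.IsErgodic μ)
    {I : Ideal C(K, ℂ)} (hI : IsClosed (I : Set C(K, ℂ)))
    (hinv : ∀ T ∈ S.ops, ∀ f ∈ I, T f ∈ I) (hle : ¬ I ≤ absKernel μ) :
    (μ : Measure K) (ContinuousMap.setOfIdeal I)ᶜ = 0 := by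
  set U := ContinuousMap.setOfIdeal I with hUdef
  have hU : IsOpen U := ContinuousMap.setOfIdeal_open I
  have hoff : ∀ f ∈ I, ∀ x ∉ U, f x = 0 := fun f hf x hx =>
    ContinuousMap.notMem_setOfIdeal.1 hx hf
  have := hμ.1.1
  set h := indicatorConstLp 1 hU.measurableSet (measure_ne_top (μ : Measure K) U) (1 : ℂ) with hh
  have hfix : h ∈ S.fixL1 μ := by
    intro T hT
    have hr : ∀ n : ℕ, (μ : Measure K).real U - 1 / ((n : ℝ) + 1) < (μ : Measure K).real U :=
      fun n => sub_lt_self _ (by positivity)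
    choose f hf01 hf0 hfr using fun n => exists_bump hU (hr n)
    have hfI : ∀ n, f n ∈ I := fun n => mem_of_eq_zero hI (hf0 n)
    have h1 : Tendsto (fun n => toL1 μ (f n)) atTop (𝓝 h) := by
      refine tendsto_iff_norm_sub_tendsto_zero.2 (squeeze_zero (fun n => norm_nonneg _)
        (fun n => ?_) (tendsto_one_div_add_atTop_nhds_zero_nat (𝕜 := ℝ)))
      rw [norm_sub_rev, norm_indicator_sub hU _ (hf01 n) (hf0 n)]
      linarith [hfr n]
    have h2 : Tendsto (fun n => toL1 μ (T (f n))) atTop (𝓝 h) := by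
      refine tendsto_iff_norm_sub_tendsto_zero.2 (squeeze_zero (fun n => norm_nonneg _)
        (fun n => ?_) (tendsto_one_div_add_atTop_nhds_zero_nat (𝕜 := ℝ)))
      have hT01 : ∀ x, 0 ≤ T (f n) x ∧ T (f n) x ≤ 1 := fun x => by
        refine ⟨(S.markov T hT).nonneg _ (fun y => (hf01 n y).1) x, ?_⟩
        have := (S.markov T hT).nonneg (1 - f n) (fun y => by simpa using (hf01 n y).2) x
        simpa [(S.markov T hT).map_one] using this
      rw [norm_sub_rev, norm_indicator_sub hU _ hT01 (hoff _ (hinv T hT _ (hfI n))),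
        hμ.1.2 T hT]
      linarith [hfr n]
    have h3 := ((inducedL1 T μ).continuous.tendsto h).comp h1
    refine tendsto_nhds_unique h3 (h2.congr fun n => ?_)
    exact (inducedL1_toL1 hμ.1 hT (f n)).symm
  have hone : toL1 μ 1 ∈ S.fixL1 μ := by
    intro T hT
    rw [inducedL1_toL1 hμ.1 hT, (S.markov T hT).map_one]
  have hone_ne : toL1 μ 1 ≠ 0 := by
    intro h0
    have := norm_toL1 μ 1
    rw [h0, norm_zero] at this
    simp only [ContinuousMap.one_apply, norm_one, integral_const, probReal_univ, smul_eq_mul,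
      mul_one] at this
    exact zero_ne_one this
  obtain ⟨c, hc⟩ := (finrank_eq_one_iff_of_nonzero' (⟨toL1 μ 1, hone⟩ : S.fixL1 μ)
    (fun h0 => hone_ne (congrArg Subtype.val h0))).1 hμ.2 ⟨h, hfix⟩
  replace hc : c • toL1 μ 1 = h := congrArg Subtype.val hc
  have hae : ∀ᵐ x ∂(μ : Measure K), U.indicator (fun _ => (1 : ℂ)) x = c := by
    filter_upwards [ContinuousMap.coeFn_toLp (p := 1) (𝕜 := ℂ) (μ : Measure K) (1 : C(K, ℂ)),
      Lp.coeFn_smul c (toL1 μ 1),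
      indicatorConstLp_coeFn (p := 1) (hs := hU.measurableSet)
        (hμs := measure_ne_top (μ : Measure K) U) (c := (1 : ℂ))] with x hx1 hx2 hx3
    rw [← hx3, ← hh, ← hc, hx2, Pi.smul_apply, toL1, hx1]
    simp
  by_cases hc1 : c = 1
  · rw [← mem_ae_iff]
    filter_upwards [hae] with x hx
    by_contra hxU
    simp [hxU, hc1] at hx
  · exfalso
    refine hle fun f hf => ?_
    change ∫ x, ‖f x‖ ∂(μ : Measure K) = 0
    refine integral_eq_zero_of_ae ?_
    filter_upwards [hae] with x hx
    have hxU : x ∉ U := fun hxU => hc1 (by simpa [hxU] using hx.symm)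
    simp [hoff f hf x hxU]

theorem le_or_le {S : MarkovSemigroup K} {μ : ProbabilityMeasure K} (hμ : S.IsErgodic μ)
    {I J : Ideal C(K, ℂ)} (hI : IsClosed (I : Set C(K, ℂ))) (hJ : IsClosed (J : Set C(K, ℂ)))
    (hIinv : ∀ T ∈ S.ops, ∀ f ∈ I, T f ∈ I) (hJinv : ∀ T ∈ S.ops, ∀ f ∈ J, T f ∈ J)
    (h : I ⊓ J ≤ absKernel μ) : I ≤ absKernel μ ∨ J ≤ absKernel μ := by
  by_contra! hcon
  have hI0 := full_of_not_le hμ hI hIinv hcon.1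
  have hJ0 := full_of_not_le hμ hJ hJinv hcon.2
  have := hμ.1.1
  set U := ContinuousMap.setOfIdeal I ∩ ContinuousMap.setOfIdeal J with hUdef
  have hU : IsOpen U := (ContinuousMap.setOfIdeal_open I).inter (ContinuousMap.setOfIdeal_open J)
  have hUc : (μ : Measure K) Uᶜ = 0 := by
    rw [hUdef, compl_inter]
    exact measure_union_null hI0 hJ0
  have hU1 : 0 < (μ : Measure K).real U := by
    rw [Measure.real, (prob_compl_eq_zero_iff hU.measurableSet).1 hUc]
    simp
  obtain ⟨f, -, hf0, hfr⟩ := exists_bump hU hU1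
  have hf : f ∈ absKernel μ := h ⟨mem_of_eq_zero hI fun x hx => hf0 x fun hxU => hx hxU.1,
    mem_of_eq_zero hJ fun x hx => hf0 x fun hxU => hx hxU.2⟩
  change ∫ x, ‖f x‖ ∂(μ : Measure K) = 0 at hf
  have h1 := (Complex.re_le_norm _).trans
    (norm_integral_le_integral_norm (μ := (μ : Measure K)) (f := f))
  linarith

theorem isClosed_ker (S : MarkovSemigroup K) (A : Set S.Prim) :
    IsClosed (S.ker A : Set C(K, ℂ)) := by
  have : (S.ker A : Set C(K, ℂ)) = ⋂ p ∈ A, ((p : Ideal C(K, ℂ)) : Set C(K, ℂ)) := by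
    simp [ker]
  rw [this]
  exact isClosed_biInter fun p _ => p.2.1.isClosed

theorem ker_invariant (S : MarkovSemigroup K) (A : Set S.Prim) :
    ∀ T ∈ S.ops, ∀ f ∈ S.ker A, T f ∈ S.ker A := by
  intro T hT f hf
  simp only [ker, Ideal.mem_iInf] at hf ⊢
  exact fun p hp => p.2.1.invariant T hT f (hf p hp)

theorem subset_hull_ker (S : MarkovSemigroup K) (A : Set S.Prim) : A ⊆ S.hull (S.ker A) := by
  intro p hp
  exact (iInf₂_le p hp : S.ker A ≤ p)

theorem hull_ker_mono (S : MarkovSemigroup K) {A B : Set S.Prim} (h : A ⊆ B) :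
    S.hull (S.ker A) ⊆ S.hull (S.ker B) := by
  intro p hp
  exact (biInf_mono h : S.ker B ≤ S.ker A).trans hp

theorem hull_ker_idem (S : MarkovSemigroup K) (A : Set S.Prim) :
    S.hull (S.ker (S.hull (S.ker A))) = S.hull (S.ker A) := by
  refine Subset.antisymm (fun p hp => ?_) (S.subset_hull_ker _)
  exact (le_iInf₂ fun q hq => hq : S.ker A ≤ S.ker (S.hull (S.ker A))).trans hp

theorem hull_ker_empty (S : MarkovSemigroup K) : S.hull (S.ker ∅) = ∅ := by
  refine eq_empty_of_forall_notMem fun p hp => p.2.1.proper (top_le_iff.1 ?_)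
  have : S.ker ∅ ≤ (p : Ideal C(K, ℂ)) := hp
  simpa [ker] using this

theorem hull_ker_union (S : MarkovSemigroup K) (A B : Set S.Prim) :
    S.hull (S.ker (A ∪ B)) = S.hull (S.ker A) ∪ S.hull (S.ker B) := by
  refine Subset.antisymm (fun p hp => ?_) (union_subset (S.hull_ker_mono subset_union_left)
    (S.hull_ker_mono subset_union_right))
  have h : S.ker (A ∪ B) ≤ (p : Ideal C(K, ℂ)) := hp
  obtain ⟨μ, hμ, hpμ⟩ := p.2.2
  rw [ker, iInf_union, hpμ] at h
  have := le_or_le hμ (S.isClosed_ker A) (S.isClosed_ker B) (S.ker_invariant A)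
    (S.ker_invariant B) h
  rw [← hpμ] at this
  exact this

/-- The hull-kernel topology on the primitive spectrum: the topology whose closure operator is
`A ↦ hull (ker A)`. -/
instance hullKernelTopology (S : MarkovSemigroup K) : TopologicalSpace S.Prim :=
  TopologicalSpace.ofClosed {A : Set S.Prim | S.hull (S.ker A) = A} S.hull_ker_empty
    (by
      intro 𝒜 h𝒜
      refine Subset.antisymm (subset_sInter fun A hA => ?_) (S.subset_hull_ker _)
      exact (S.hull_ker_mono (sInter_subset_of_mem hA)).trans (h𝒜 hA).subset)
    (by
      intro A hA B hB
      change S.hull (S.ker (A ∪ B)) = A ∪ B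
      rw [hull_ker_union, hA, hB])

theorem isClosed_iff (S : MarkovSemigroup K) (A : Set S.Prim) :
    IsClosed A ↔ S.hull (S.ker A) = A := by
  rw [← isOpen_compl_iff]
  change Aᶜᶜ ∈ {A : Set S.Prim | S.hull (S.ker A) = A} ↔ _
  rw [compl_compl]; rfl

theorem closure_eq (S : MarkovSemigroup K) (A : Set S.Prim) :
    closure A = S.hull (S.ker A) := by
  refine Subset.antisymm (closure_minimal (S.subset_hull_ker A)
    ((S.isClosed_iff _).2 (S.hull_ker_idem A))) ?_
  exact (S.hull_ker_mono subset_closure).trans ((S.isClosed_iff _).1 isClosed_closure).subset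

end Ergodic

end MarkovSemigroup

end

set_option linter.unusedSectionVars false

/-! The zero set of an ideal is the set of points where all its elements vanish; it determines a
closed ideal of C(K). Everything rests on `exists_prim_ge`: a proper invariant ideal lies below a
primitive one. Averaging the orbit of a point in the zero set of its closure with the right
invariant mean gives an invariant state that kills the closure. Such states form a weak* compact
set, which has an extreme point by Krein–Milman, and extreme states come from ergodic measures
(`exists_isErgodic_of_extreme`).

That last claim is the analytic core. For h in L¹ fixed by the semigroup, the truncations of Re h
are bounded densities of invariant functionals (`integral_clamp_mul_map`). Extremality makes them
constant, hence Re h is constant; the same applied to -ih settles Im h. Invariance of the truncated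
densities is proved on almost fixed continuous functions: being almost fixed survives moduli, hence
truncation, and a positive unital operator R nearly satisfies R(gk) = k R(g) when k is almost fixed
and bounded.

By ergodicity a fixed function is constant modulo each primitive ideal, and its transform is that
constant. Radical freeness gives the converse (`RadicalFree.mem_fix`), so the fixed space is stable
under continuous functional calculus, in particular under conjugation and modulus. It also makes the
union of the zero sets dense, whence the isometry. By `exists_prim_ge`, the primitive spectrum is
quasi-compact and disjoint closed subsets of it have kernels with disjoint zero sets. This
separation extends a continuous function on the spectrum, transported to the dense union,
continuously to K, which proves surjectivity. -/

/-! ### Truncation -/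

/-- Truncation of a real number to the interval `[-N, N]`. -/
noncomputable def clamp (N t : ℝ) : ℝ := (|t + N| - |t - N|) / 2

theorem continuous_clamp (N : ℝ) : Continuous (clamp N) := by
  unfold clamp; fun_prop

theorem abs_clamp_le {N : ℝ} (hN : 0 ≤ N) (t : ℝ) : |clamp N t| ≤ N := by
  unfold clamp
  rw [abs_le]
  constructor <;>
    rcases abs_cases (t + N) with ⟨h, _⟩ | ⟨h, _⟩ <;>
    rcases abs_cases (t - N) with ⟨h', _⟩ | ⟨h', _⟩ <;> rw [h, h'] <;> linarith

theorem abs_clamp_sub_le (N s t : ℝ) : |clamp N s - clamp N t| ≤ |s - t| := by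
  have h1 := abs_abs_sub_abs_le_abs_sub (s + N) (t + N)
  have h2 := abs_abs_sub_abs_le_abs_sub (s - N) (t - N)
  rw [add_sub_add_right_eq_sub] at h1
  rw [sub_sub_sub_cancel_right] at h2
  unfold clamp
  rw [abs_le] at *
  constructor <;> linarith

theorem clamp_eq_self {N t : ℝ} (h : |t| ≤ N) : clamp N t = t := by
  rw [abs_le] at h
  unfold clamp
  rw [abs_of_nonneg (by linarith), abs_of_nonpos (by linarith)]
  ring

/-- Outside the interval the truncation takes an endpoint value. This recovers a function from a
truncation that is constant and strictly inside. -/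
theorem clamp_eq_self_of_abs_clamp_lt {N t : ℝ} (h : |clamp N t| < N) : clamp N t = t := by
  apply clamp_eq_self
  by_contra! hlt
  rw [abs_lt] at h
  unfold clamp at h
  rcases lt_abs.1 hlt with h' | h'
  · rw [abs_of_nonneg (show 0 ≤ t - N by linarith)] at h
    rcases abs_cases (t + N) with ⟨e, -⟩ | ⟨e, -⟩ <;> rw [e] at h <;> linarith [h.1, h.2]
  · rw [abs_of_nonpos (show t + N ≤ 0 by linarith)] at h
    rcases abs_cases (t - N) with ⟨e, -⟩ | ⟨e, -⟩ <;> rw [e] at h <;> linarith [h.1, h.2]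

/-- Truncation of a continuous function to the interval `[-N, N]`. -/
noncomputable def clampMap {K : Type*} [TopologicalSpace K] (N : ℝ) (f : C(K, ℝ)) : C(K, ℝ) :=
  ⟨fun x => clamp N (f x), (continuous_clamp N).comp f.continuous⟩

/-! ### Almost fixed functions of positive unital operators -/

/-- Positive unital operators on the real Banach lattice `C(K, ℝ)` that preserve a probability
measure. -/
structure PreservesIntegral {K : Type*} [TopologicalSpace K] [MeasurableSpace K]
    (R : C(K, ℝ) →ₗ[ℝ] C(K, ℝ)) (μ : ProbabilityMeasure K) : Prop where
  nonneg : ∀ g, 0 ≤ g → 0 ≤ R g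
  map_one : R 1 = 1
  integral_map : ∀ g, ∫ x, R g x ∂(μ : Measure K) = ∫ x, g x ∂(μ : Measure K)

namespace PreservesIntegral

variable {K : Type*} [TopologicalSpace K] [CompactSpace K] [MeasurableSpace K] [BorelSpace K]
  {R : C(K, ℝ) →ₗ[ℝ] C(K, ℝ)} {μ : ProbabilityMeasure K}

theorem map_le (h : PreservesIntegral R μ) {f g : C(K, ℝ)} (hfg : f ≤ g) (x : K) :
    R f x ≤ R g x := by
  have h0 : 0 ≤ R (g - f) := h.nonneg _ (sub_nonneg.2 hfg)
  have := h0 x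
  rw [map_sub] at this
  simpa using this

theorem abs_map_le (h : PreservesIntegral R μ) (f : C(K, ℝ)) (x : K) :
    |R f x| ≤ R |f| x := by
  have h1 := h.map_le (le_abs_self f) x
  have h2 := h.map_le (neg_le_abs f) x
  rw [map_neg] at h2
  rw [abs_le]
  simp only [ContinuousMap.neg_apply] at h2
  constructor <;> linarith

/-- The difference R|f| - |Rf| is nonnegative, and since R preserves the integral its integral is
that of |f| - |Rf|, at most the L¹ norm of Rf - f. The triangle inequality between |Rf| and |f|
costs that norm a second time. -/
theorem integral_abs_map_abs_sub_le (h : PreservesIntegral R μ) (f : C(K, ℝ)) :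
    ∫ x, |R |f| x - |f| x| ∂(μ : Measure K) ≤ 2 * ∫ x, |R f x - f x| ∂(μ : Measure K) := by
  have i1 := integrable_cont μ (R |f|)
  have i2 := integrable_cont μ |R f|
  have i3 := integrable_cont μ |R f - f|
  have i4 := integrable_cont μ |f|
  have e1 : ∫ x, |R |f| x - |f| x| ∂(μ : Measure K)
      ≤ ∫ x, ((R |f| x - |R f| x) + |R f - f| x) ∂(μ : Measure K) := by
    refine integral_mono (integrable_cont μ (abs (R |f| - |f|))) ((i1.sub i2).add i3) fun x => ?_
    have a1 := h.abs_map_le f x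
    have a2 := abs_abs_sub_abs_le_abs_sub (R f x) (f x)
    simp only [ContinuousMap.abs_apply, ContinuousMap.sub_apply] at *
    calc abs (R |f| x - abs (f x)) = abs ((R |f| x - abs (R f x)) + (abs (R f x) - abs (f x))) := by ring_nf
      _ ≤ _ := (abs_add_le _ _).trans (add_le_add (abs_of_nonneg (by linarith)).le a2)
  have e2 : ∫ x, ((R |f| x - |R f| x) + |R f - f| x) ∂(μ : Measure K)
      = (∫ x, (|f| x - |R f| x) ∂(μ : Measure K)) + ∫ x, |R f - f| x ∂(μ : Measure K) := by
    have i5 : Integrable (fun x => R |f| x - |R f| x) (μ : Measure K) := i1.sub i2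
    rw [integral_add i5 i3, integral_sub i1 i2, h.integral_map, integral_sub i4 i2]
  have e3 : ∫ x, (|f| x - |R f| x) ∂(μ : Measure K) ≤ ∫ x, |R f - f| x ∂(μ : Measure K) := by
    refine integral_mono (i4.sub i2) i3 fun x => ?_
    have := abs_sub_abs_le_abs_sub (f x) (R f x)
    rw [abs_sub_comm] at this
    simpa using this
  have e4 : ∫ x, |R f - f| x ∂(μ : Measure K) = ∫ x, |R f x - f x| ∂(μ : Measure K) := by
    simp [ContinuousMap.abs_apply]
  rw [e4] at e2 e3
  linarith

theorem integral_abs_map_add_const_sub (h : PreservesIntegral R μ) (f : C(K, ℝ)) (c : ℝ) :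
    ∫ x, |R |f + c • (1 : C(K, ℝ))| x - |f + c • (1 : C(K, ℝ))| x| ∂(μ : Measure K)
      ≤ 2 * ∫ x, |R f x - f x| ∂(μ : Measure K) := by
  refine (h.integral_abs_map_abs_sub_le _).trans (le_of_eq ?_)
  simp [map_add, h.map_one]

/-- Truncation is half a difference of two moduli of translates of f by constants, and R fixes
constants, so the estimate for moduli applies twice. -/
theorem integral_abs_map_clampMap_sub_le (h : PreservesIntegral R μ) (N : ℝ) (f : C(K, ℝ)) :
    ∫ x, |R (clampMap N f) x - clampMap N f x| ∂(μ : Measure K)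
      ≤ 2 * ∫ x, |R f x - f x| ∂(μ : Measure K) := by
  have hc : clampMap N f = (1 / 2 : ℝ) • (|f + N • (1 : C(K, ℝ))| - |f + (-N) • (1 : C(K, ℝ))|) := by
    ext x
    simp [clampMap, clamp, sub_eq_add_neg]
    ring
  have h1 := h.integral_abs_map_add_const_sub f N
  have h2 := h.integral_abs_map_add_const_sub f (-N)
  have i1 : Integrable (fun x => |R |f + N • (1 : C(K, ℝ))| x - |f + N • (1 : C(K, ℝ))| x|) (μ : Measure K) :=
    integrable_cont μ (abs (R |f + N • (1 : C(K, ℝ))| - |f + N • (1 : C(K, ℝ))|))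
  have i2 : Integrable (fun x => |R |f + (-N) • (1 : C(K, ℝ))| x - |f + (-N) • (1 : C(K, ℝ))| x|) (μ : Measure K) :=
    integrable_cont μ (abs (R |f + (-N) • (1 : C(K, ℝ))| - |f + (-N) • (1 : C(K, ℝ))|))
  have h3 : ∫ x, |R (clampMap N f) x - clampMap N f x| ∂(μ : Measure K)
      ≤ ∫ x, (1 / 2 : ℝ) * (|R |f + N • (1 : C(K, ℝ))| x - |f + N • (1 : C(K, ℝ))| x|
        + |R |f + (-N) • (1 : C(K, ℝ))| x - |f + (-N) • (1 : C(K, ℝ))| x|) ∂(μ : Measure K) := by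
    refine integral_mono (integrable_cont μ |R (clampMap N f) - clampMap N f|)
      ((i1.add i2).const_mul _) fun x => ?_
    dsimp only
    rw [hc, map_smul, map_sub]
    simp only [ContinuousMap.smul_apply, ContinuousMap.sub_apply, smul_eq_mul]
    rw [← mul_sub, abs_mul, abs_of_pos (by norm_num : (0 : ℝ) < 1 / 2)]
    refine mul_le_mul_of_nonneg_left ?_ (by norm_num)
    rw [sub_sub_sub_comm]
    exact abs_sub _ _
  rw [integral_const_mul, integral_add i1 i2] at h3
  linarith

/-- Freezing k at x turns the left side into R(g(k - k(x)))(x), to which a weighted AM–GM inequality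
under R applies. The last bracket is R((k - k(x))²)(x), expanded so that it can be integrated over
x. -/
theorem abs_map_mul_sub_le (h : PreservesIntegral R μ) {ε : ℝ} (hε : 0 < ε) (g k : C(K, ℝ))
    (x : K) :
    |R (g * k) x - k x * R g x|
      ≤ ε / 2 * R (g * g) x + 1 / (2 * ε) * (R (k * k) x - 2 * k x * R k x + k x * k x) := by
  set w : C(K, ℝ) := k - (k x) • 1 with hw
  have e1 : R (g * k) x - k x * R g x = R (g * w) x := by
    have : g * w = g * k - (k x) • g := by ext y; simp [hw]; ring
    rw [this, map_sub, map_smul]; simp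
  have e2 : R (k * k) x - 2 * k x * R k x + k x * k x = R (w * w) x := by
    have : w * w = k * k - (2 * k x) • k + (k x * k x) • 1 := by ext y; simp [hw]; ring
    rw [this, map_add, map_sub, map_smul, map_smul, h.map_one]; simp
  rw [e1, e2]
  have e3 : ε / 2 * R (g * g) x + 1 / (2 * ε) * R (w * w) x
      = R ((ε / 2) • (g * g) + (1 / (2 * ε)) • (w * w)) x := by
    simp [map_add, map_smul]
  rw [e3]
  refine (h.abs_map_le _ x).trans (h.map_le (fun y => ?_) x)
  change |g y * w y| ≤ ε / 2 * (g y * g y) + 1 / (2 * ε) * (w y * w y)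
  -- The defect in the inequality is the square (εa - b)²/(2ε).
  have key : ∀ a b : ℝ, a * b ≤ ε / 2 * (a * a) + 1 / (2 * ε) * (b * b) := fun a b => by
    have : ε / 2 * (a * a) + 1 / (2 * ε) * (b * b) - a * b = (ε * a - b) ^ 2 / (2 * ε) := by
      field_simp; ring
    have h2 : 0 ≤ (ε * a - b) ^ 2 / (2 * ε) := by positivity
    linarith
  rw [abs_le]
  have k1 := key (g y) (w y)
  have k2 := key (-g y) (w y)
  constructor
  · rw [neg_mul_neg] at k2; linarith
  · exact k1

/-- Since R(k²) and k² have the same integral, the integrated bracket of `abs_map_mul_sub_le` is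
twice the integral of k(k - Rk), which is small when k is bounded and almost fixed. -/
theorem abs_integral_mul_map_sub_le (h : PreservesIntegral R μ) {ε N : ℝ} (hε : 0 < ε)
    (g k : C(K, ℝ)) (hk : ∀ x, |k x| ≤ N) :
    |∫ x, k x * R g x ∂(μ : Measure K) - ∫ x, k x * g x ∂(μ : Measure K)|
      ≤ ε / 2 * ∫ x, g x * g x ∂(μ : Measure K)
        + N / ε * ∫ x, |R k x - k x| ∂(μ : Measure K) := by
  have i1 := integrable_cont μ (R (g * k))
  have i2 : Integrable (fun x => k x * R g x) (μ : Measure K) := integrable_cont μ (k * R g)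
  have i3 := integrable_cont μ (R (g * g))
  have i4 := integrable_cont μ (R (k * k))
  have i5 : Integrable (fun x => 2 * k x * R k x) (μ : Measure K) :=
    integrable_cont μ ((2 : ℝ) • k * R k)
  have i6 : Integrable (fun x => k x * k x) (μ : Measure K) := integrable_cont μ (k * k)
  have i7 : Integrable (fun x => |R k x - k x|) (μ : Measure K) := integrable_cont μ |R k - k|
  have e1 : ∫ x, k x * g x ∂(μ : Measure K) = ∫ x, R (g * k) x ∂(μ : Measure K) := by
    rw [h.integral_map]
    simp [mul_comm]
  rw [e1, abs_sub_comm, ← integral_sub i1 i2]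
  refine (abs_integral_le_integral_abs).trans ?_
  have e2 : ∫ x, |R (g * k) x - k x * R g x| ∂(μ : Measure K)
      ≤ ∫ x, (ε / 2 * R (g * g) x
        + 1 / (2 * ε) * (R (k * k) x - 2 * k x * R k x + k x * k x)) ∂(μ : Measure K) :=
    integral_mono (i1.sub i2).abs ((i3.const_mul _).add (((i4.sub i5).add i6).const_mul _))
      (h.abs_map_mul_sub_le hε g k)
  refine e2.trans ?_
  have i8 : Integrable (fun x => R (k * k) x - 2 * k x * R k x) (μ : Measure K) := i4.sub i5
  have i9 : Integrable (fun x => R (k * k) x - 2 * k x * R k x + k x * k x) (μ : Measure K) :=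
    i8.add i6
  rw [integral_add (i3.const_mul _) (i9.const_mul _),
    integral_const_mul, integral_const_mul, integral_add i8 i6, integral_sub i4 i5, h.integral_map, h.integral_map]
  have e3 : ∫ x, (k * k) x ∂(μ : Measure K) - ∫ x, 2 * k x * R k x ∂(μ : Measure K)
      + ∫ x, k x * k x ∂(μ : Measure K) ≤ 2 * N * ∫ x, |R k x - k x| ∂(μ : Measure K) := by
    have e4 : ∫ x, (k * k) x ∂(μ : Measure K) = ∫ x, k x * k x ∂(μ : Measure K) := rfl
    have i10 : Integrable (fun x => k x * k x - 2 * k x * R k x) (μ : Measure K) := i6.sub i5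
    rw [e4, ← integral_sub i6 i5, ← integral_add i10 i6, ← integral_const_mul]
    refine integral_mono (i10.add i6) (i7.const_mul _) fun x => ?_
    dsimp only
    have a1 : k x * (k x - R k x) ≤ N * |R k x - k x| := by
      refine (le_abs_self _).trans ?_
      rw [abs_mul, abs_sub_comm]
      exact mul_le_mul_of_nonneg_right (hk x) (abs_nonneg _)
    linarith
  have e5 : N / ε * ∫ x, |R k x - k x| ∂(μ : Measure K)
      = 1 / (2 * ε) * (2 * N * ∫ x, |R k x - k x| ∂(μ : Measure K)) := by
    field_simp
  rw [e5]
  simp only [ContinuousMap.mul_apply] at *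
  gcongr

/-- If `h` is an `L¹`-limit of almost `R`-fixed continuous functions, then its truncations are
densities of `R`-invariant functionals. -/
theorem integral_clamp_mul_map (hR : PreservesIntegral R μ) {h : K → ℝ}
    (hi : Integrable h (μ : Measure K))
    (happ : ∀ ε > 0, ∃ f : C(K, ℝ), ∫ x, |f x - h x| ∂(μ : Measure K) ≤ ε ∧
      ∫ x, |R f x - f x| ∂(μ : Measure K) ≤ ε) {N : ℝ} (hN : 0 ≤ N) (g : C(K, ℝ)) :
    ∫ x, clamp N (h x) * R g x ∂(μ : Measure K) = ∫ x, clamp N (h x) * g x ∂(μ : Measure K) := by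
  have hci : Integrable (fun x => clamp N (h x)) (μ : Measure K) :=
    Integrable.of_bound ((continuous_clamp N).comp_aestronglyMeasurable hi.1) N
      (.of_forall fun x => abs_clamp_le hN _)
  have hmul : ∀ u : C(K, ℝ), Integrable (fun x => clamp N (h x) * u x) (μ : Measure K) := fun u =>
    hci.mul_bdd (c := ‖u‖) u.continuous.aestronglyMeasurable (.of_forall u.norm_coe_le_norm)
  have hmul' : ∀ f u : C(K, ℝ), Integrable (fun x => clampMap N f x * u x) (μ : Measure K) :=
    fun f u => integrable_cont μ (clampMap N f * u)
  -- Truncation is 1-Lipschitz, so replacing h by f costs at most their L¹ distance.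
  have happrox : ∀ (f u : C(K, ℝ)), |∫ x, clamp N (h x) * u x ∂(μ : Measure K)
      - ∫ x, clampMap N f x * u x ∂(μ : Measure K)| ≤ ‖u‖ * ∫ x, |f x - h x| ∂(μ : Measure K) := by
    intro f u
    rw [← integral_sub (hmul u) (hmul' f u), ← integral_const_mul]
    refine abs_integral_le_integral_abs.trans (integral_mono ((hmul u).sub (hmul' f u)).abs
      ((((integrable_cont μ f).sub hi).abs).const_mul _) fun x => ?_)
    dsimp only [Pi.sub_apply]
    rw [← sub_mul, abs_mul, mul_comm, abs_sub_comm (f x)]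
    exact mul_le_mul (u.norm_coe_le_norm x) (abs_clamp_sub_le _ _ _) (abs_nonneg _)
      (norm_nonneg _)
  have hbound : ∀ ε > 0, |∫ x, clamp N (h x) * R g x ∂(μ : Measure K)
      - ∫ x, clamp N (h x) * g x ∂(μ : Measure K)|
      ≤ ε * (‖R g‖ + ‖g‖ + ∫ x, g x * g x ∂(μ : Measure K) + 2 * N) := by
    intro ε hε
    -- The order ε² absorbs the factor N/ε in `abs_integral_mul_map_sub_le`; the order ε serves the
    -- two replacements of h by f.
    have hε' : 0 < min ε (ε * ε) := lt_min hε (mul_pos hε hε)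
    obtain ⟨f, hf1, hf2⟩ := happ _ hε'
    have a1 := happrox f (R g)
    have a2 := happrox f g
    have a3 := hR.abs_integral_mul_map_sub_le hε g (clampMap N f) (fun x => abs_clamp_le hN _)
    have a4 := hR.integral_abs_map_clampMap_sub_le N f
    have b1 : ‖R g‖ * ∫ x, |f x - h x| ∂(μ : Measure K) ≤ ‖R g‖ * ε :=
      mul_le_mul_of_nonneg_left (hf1.trans (min_le_left _ _)) (norm_nonneg _)
    have b2 : ‖g‖ * ∫ x, |f x - h x| ∂(μ : Measure K) ≤ ‖g‖ * ε :=
      mul_le_mul_of_nonneg_left (hf1.trans (min_le_left _ _)) (norm_nonneg _)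
    have b3 : N / ε * ∫ x, |R (clampMap N f) x - clampMap N f x| ∂(μ : Measure K)
        ≤ ε * (2 * N) := by
      have : N / ε * ∫ x, |R (clampMap N f) x - clampMap N f x| ∂(μ : Measure K)
          ≤ N / ε * (2 * (ε * ε)) := by
        refine mul_le_mul_of_nonneg_left (a4.trans ?_) (by positivity)
        exact mul_le_mul_of_nonneg_left (hf2.trans (min_le_right _ _)) (by norm_num)
      refine this.trans (le_of_eq ?_)
      field_simp
    have b4 : 0 ≤ ε * ∫ x, g x * g x ∂(μ : Measure K) :=
      mul_nonneg hε.le (integral_nonneg fun x => mul_self_nonneg _)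
    rw [abs_le] at *
    constructor <;> linarith [a1.1, a1.2, a2.1, a2.2, a3.1, a3.2]
  have hzero : |∫ x, clamp N (h x) * R g x ∂(μ : Measure K)
      - ∫ x, clamp N (h x) * g x ∂(μ : Measure K)| ≤ 0 := by
    set M := ‖R g‖ + ‖g‖ + ∫ x, g x * g x ∂(μ : Measure K) + 2 * N with hM
    have hlim : Tendsto (fun ε : ℝ => ε * M) (𝓝[>] 0) (𝓝 0) := by
      have : Tendsto (fun ε : ℝ => ε * M) (𝓝 0) (𝓝 (0 * M)) := by
        exact (continuous_id.mul continuous_const).tendsto 0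
      rw [zero_mul] at this
      exact this.mono_left nhdsWithin_le_nhds
    exact ge_of_tendsto hlim (eventually_mem_nhdsWithin.mono fun ε hε => hbound ε hε)
  exact sub_eq_zero.1 (abs_nonpos_iff.1 hzero)

end PreservesIntegral

/-! ### Markov operators on real-valued functions -/

section RealParts

variable {X : Type*} [TopologicalSpace X]

/-- A real-valued continuous function, regarded as a complex-valued one. -/
noncomputable def complexify (g : C(X, ℝ)) : C(X, ℂ) := ⟨fun x => (g x : ℂ), by fun_prop⟩

/-- The pointwise real part of a continuous function. -/
noncomputable def rePart (f : C(X, ℂ)) : C(X, ℝ) := ⟨fun x => (f x).re, by fun_prop⟩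

/-- The modulus of a continuous function, as a real-valued function. -/
noncomputable def normMap (f : C(X, ℂ)) : C(X, ℝ) := ⟨fun x => ‖f x‖, by fun_prop⟩

theorem complexify_rePart_add (f : C(X, ℂ)) :
    complexify (rePart f) + Complex.I • complexify (rePart (-Complex.I • f)) = f := by
  ext x
  simp only [complexify, rePart, ContinuousMap.add_apply, ContinuousMap.smul_apply,
    ContinuousMap.coe_mk, smul_eq_mul]
  have : (-Complex.I * f x).re = (f x).im := by simp
  rw [this, mul_comm, Complex.re_add_im]

end RealParts

namespace IsMarkov

variable {K : Type*} [TopologicalSpace K] [CompactSpace K] {T : C(K, ℂ) →L[ℂ] C(K, ℂ)}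

/-- Adding the constant ‖g‖ makes g nonnegative, so its image is nonnegative and in particular real,
while the constant itself is fixed. -/
theorem im_apply_complexify (hT : IsMarkov T) (g : C(K, ℝ)) (x : K) :
    (T (complexify g) x).im = 0 := by
  have h1 : complexify g = (complexify g + (‖g‖ : ℂ) • 1) - (‖g‖ : ℂ) • 1 := by abel
  have h2 := hT.nonneg (complexify g + (‖g‖ : ℂ) • 1) (fun y => by
    have := (abs_le.1 (g.norm_coe_le_norm y)).1
    simp only [complexify, ContinuousMap.add_apply, ContinuousMap.coe_mk, ContinuousMap.smul_apply,
      ContinuousMap.one_apply, smul_eq_mul, mul_one]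
    rw [← Complex.ofReal_add, Complex.zero_le_real]
    linarith) x
  have h3 := (Complex.le_def.1 h2).2
  rw [map_add, map_smul, hT.map_one] at h3
  simpa using h3.symm

end IsMarkov

section RealOp

variable {K : Type*} [TopologicalSpace K] [CompactSpace K]

/-- The operator induced on real-valued functions by an operator on complex-valued functions. -/
noncomputable def realOp (T : C(K, ℂ) →L[ℂ] C(K, ℂ)) : C(K, ℝ) →ₗ[ℝ] C(K, ℝ) where
  toFun g := rePart (T (complexify g))
  map_add' f g := by
    have : complexify (f + g) = complexify f + complexify g := by ext x; simp [complexify]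
    rw [this, map_add]
    ext x; simp [rePart]
  map_smul' c g := by
    have : complexify (c • g) = (c : ℂ) • complexify g := by ext x; simp [complexify]
    rw [this, map_smul]
    ext x; simp [rePart]

variable {T : C(K, ℂ) →L[ℂ] C(K, ℂ)}

theorem complexify_realOp (hT : IsMarkov T) (g : C(K, ℝ)) :
    complexify (realOp T g) = T (complexify g) := by
  ext x
  exact Complex.ext (by simp [complexify, realOp, rePart])
    (by rw [hT.im_apply_complexify]; simp [complexify])

theorem rePart_map (hT : IsMarkov T) (f : C(K, ℂ)) : rePart (T f) = realOp T (rePart f) := by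
  conv_lhs => rw [← complexify_rePart_add f, map_add, map_smul, ← complexify_realOp hT,
    ← complexify_realOp hT]
  ext x
  simp [rePart, complexify]

theorem realOp_nonneg (hT : IsMarkov T) {g : C(K, ℝ)} (hg : 0 ≤ g) : 0 ≤ realOp T g := fun x =>
  (Complex.le_def.1 (hT.nonneg (complexify g)
    (fun y => Complex.zero_le_real.2 (hg y)) x)).1

theorem realOp_one (hT : IsMarkov T) : realOp T 1 = 1 := by
  have : complexify (1 : C(K, ℝ)) = 1 := by ext x; simp [complexify]
  ext x
  simp [realOp, this, hT.map_one, rePart]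

theorem norm_map_apply_le [T2Space K] [MeasurableSpace K] [BorelSpace K] (hT : IsMarkov T)
    (f : C(K, ℂ)) (x : K) : ‖T f x‖ ≤ ‖f‖ := by
  have h1 := MarkovSemigroup.norm_apply_le hT f x
  have h2 := hT.nonneg ((‖f‖ : ℂ) • 1 - modulus f) (fun y => by
    simp only [modulus, ContinuousMap.sub_apply, ContinuousMap.coe_mk, ContinuousMap.smul_apply,
      ContinuousMap.one_apply, smul_eq_mul, mul_one]
    rw [← Complex.ofReal_sub, Complex.zero_le_real, sub_nonneg]
    exact f.norm_coe_le_norm y) x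
  rw [map_sub, map_smul, hT.map_one] at h2
  have h3 : ((‖T f x‖ : ℝ) : ℂ) ≤ (‖f‖ : ℝ) := h1.trans (by simpa using h2)
  exact Complex.real_le_real.1 h3

end RealOp

/-! ### States and measures -/

section Measures

variable {K : Type*} [TopologicalSpace K] [CompactSpace K] [T2Space K] [MeasurableSpace K]
  [BorelSpace K]

/-- The Riesz representation theorem for states of `C(K, ℝ)`. -/
theorem exists_probabilityMeasure_integral_eq (φ : C(K, ℝ) →ₗ[ℝ] ℝ) (hpos : ∀ g, 0 ≤ g → 0 ≤ φ g)
    (hone : φ 1 = 1) : ∃ μ : ProbabilityMeasure K, (μ : Measure K).Regular ∧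
      ∀ g : C(K, ℝ), ∫ x, g x ∂(μ : Measure K) = φ g := by
  let Λ : CompactlySupportedContinuousMap K ℝ →ₚ[ℝ] ℝ := PositiveLinearMap.mk₀
    { toFun := fun g => φ g.toContinuousMap
      map_add' := fun f g => by rw [← map_add]; rfl
      map_smul' := fun c g => by
        rw [RingHom.id_apply, ← map_smul]; rfl } fun g hg => hpos _ hg
  have key : ∀ g : C(K, ℝ), ∫ x, g x ∂(RealRMK.rieszMeasure Λ) = φ g := fun g =>
    RealRMK.integral_rieszMeasure Λ (CompactlySupportedContinuousMap.continuousMapEquiv g)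
  have hprob : IsProbabilityMeasure (RealRMK.rieszMeasure Λ) := by
    have h1 := key 1
    rw [hone] at h1
    simp only [ContinuousMap.one_apply, integral_const, smul_eq_mul, mul_one] at h1
    constructor
    rw [Measure.real] at h1
    exact (ENNReal.toReal_eq_one_iff _).1 h1
  exact ⟨⟨RealRMK.rieszMeasure Λ, hprob⟩, RealRMK.regular_rieszMeasure Λ, key⟩

/-- For continuous g the integral of w² equals that of w(w - g), hence is at most M times the L¹
distance from w to g; continuous functions are dense in L¹. -/
theorem ae_eq_zero_of_integral_mul_eq_zero {μ : Measure K} [IsFiniteMeasure μ] [μ.Regular]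
    {w : K → ℝ} (hw : AEStronglyMeasurable w μ) {M : ℝ} (hM : ∀ x, |w x| ≤ M)
    (h : ∀ g : C(K, ℝ), ∫ x, w x * g x ∂μ = 0) : w =ᵐ[μ] 0 := by
  rcases isEmpty_or_nonempty K with hK | ⟨⟨y⟩⟩
  · exact .of_forall fun x => isEmptyElim x
  have hM0 : 0 ≤ M := (abs_nonneg _).trans (hM y)
  have hi : Integrable w μ := Integrable.of_bound hw M (.of_forall hM)
  have hw2 : Integrable (fun x => w x * w x) μ := hi.mul_bdd (c := M) hw (.of_forall hM)
  have hle : ∀ ε > 0, ∫ x, w x * w x ∂μ ≤ M * ε := by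
    intro ε hε
    obtain ⟨g, -, hg, hgc, hgi⟩ := hi.exists_hasCompactSupport_integral_sub_le hε
    have hwg : Integrable (fun x => w x * g x) μ := by
      simpa only [mul_comm] using hgi.mul_bdd (c := M) hw (.of_forall hM)
    have e1 : ∫ x, w x * w x ∂μ = ∫ x, w x * (w x - g x) ∂μ := by
      simp_rw [mul_sub]
      rw [integral_sub hw2 hwg, show ∫ x, w x * g x ∂μ = 0 from h ⟨g, hgc⟩, sub_zero]
    have e2 : ∫ x, w x * (w x - g x) ∂μ ≤ ∫ x, M * ‖w x - g x‖ ∂μ := by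
      refine integral_mono ?_ ((hi.sub hgi).norm.const_mul _) fun x => ?_
      · simp_rw [mul_sub]; exact hw2.sub hwg
      · refine (le_abs_self _).trans ?_
        rw [abs_mul]
        exact mul_le_mul_of_nonneg_right (hM x) (abs_nonneg _)
    rw [integral_const_mul] at e2
    exact e1.le.trans (e2.trans (mul_le_mul_of_nonneg_left hg hM0))
  have h0 : ∫ x, w x * w x ∂μ = 0 := by
    refine le_antisymm ?_ (integral_nonneg fun x => mul_self_nonneg _)
    have hlim : Tendsto (fun ε : ℝ => M * ε) (𝓝[>] 0) (𝓝 0) := by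
      have : Tendsto (fun ε : ℝ => M * ε) (𝓝 0) (𝓝 (M * 0)) :=
        (continuous_const.mul continuous_id).tendsto 0
      rw [mul_zero] at this
      exact this.mono_left nhdsWithin_le_nhds
    exact ge_of_tendsto hlim (eventually_mem_nhdsWithin.mono fun ε hε => hle ε hε)
  filter_upwards [(integral_eq_zero_iff_of_nonneg (fun x => mul_self_nonneg (w x)) hw2).1 h0]
    with x hx
  simpa using hx

end Measures

/-! ### Invariant states -/

namespace MarkovSemigroup

section Functionals

variable {K : Type*} [TopologicalSpace K] [CompactSpace K]

/-- The states of `C(K, ℝ)` that are invariant under the semigroup and vanish on the moduli of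
the elements of `I`. -/
def invariantStates (S : MarkovSemigroup K) (I : Ideal C(K, ℂ)) : Set (WeakDual ℝ C(K, ℝ)) :=
  {φ | (∀ g, 0 ≤ g → 0 ≤ φ g) ∧ φ 1 = 1 ∧ (∀ T ∈ S.ops, ∀ g, φ (realOp T g) = φ g) ∧
    ∀ f ∈ I, φ (normMap f) = 0}

/-- All conditions are weak* closed, and positivity with unitality forces norm at most one, so
Banach–Alaoglu applies. -/
theorem isCompact_invariantStates (S : MarkovSemigroup K) (I : Ideal C(K, ℂ)) :
    IsCompact (S.invariantStates I) := by
  refine (WeakDual.isCompact_closedBall (𝕜 := ℝ) (E := C(K, ℝ)) 0 1).of_isClosed_subset ?_ ?_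
  · have hc := fun g : C(K, ℝ) => WeakDual.eval_continuous (𝕜 := ℝ) g
    have : S.invariantStates I = {φ | ∀ g, 0 ≤ g → 0 ≤ φ g} ∩ ({φ | φ 1 = 1} ∩
        ({φ | ∀ T ∈ S.ops, ∀ g, φ (realOp T g) = φ g} ∩ {φ | ∀ f ∈ I, φ (normMap f) = 0})) := rfl
    rw [this]
    refine IsClosed.inter ?_ (IsClosed.inter ?_ (IsClosed.inter ?_ ?_))
    · simp only [ofPred_forall]
      exact isClosed_iInter fun g => isClosed_iInter fun _ => isClosed_le continuous_const (hc g)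
    · exact isClosed_eq (hc 1) continuous_const
    · simp only [ofPred_forall]
      exact isClosed_iInter fun T => isClosed_iInter fun _ => isClosed_iInter fun g =>
        isClosed_eq (hc _) (hc g)
    · simp only [ofPred_forall]
      exact isClosed_iInter fun f => isClosed_iInter fun _ => isClosed_eq (hc _) continuous_const
  · rintro φ ⟨hpos, hone, -, -⟩
    rw [mem_preimage, mem_closedBall_zero_iff]
    refine ContinuousLinearMap.opNorm_le_bound _ zero_le_one fun g => ?_
    change |φ g| ≤ 1 * ‖g‖
    have key : ∀ u : C(K, ℝ), φ u ≤ ‖u‖ := fun u => by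
      have h := hpos (‖u‖ • 1 - u) fun x => by
        simpa using (le_abs_self _).trans (u.norm_coe_le_norm x)
      rw [map_sub, map_smul, hone] at h
      simpa using h
    rw [one_mul, abs_le]
    have h2 := key (-g)
    rw [map_neg, norm_neg] at h2
    exact ⟨by linarith, key g⟩

/-- Required by the Krein–Milman theorem. -/
instance : LocallyConvexSpace ℝ (WeakDual ℝ C(K, ℝ)) :=
  inferInstanceAs (LocallyConvexSpace ℝ (WeakBilin (topDualPairing ℝ C(K, ℝ))))

variable [T2Space K] [MeasurableSpace K] [BorelSpace K]

/-- The bounded continuous function `U ↦ (U f)(x)` on the semigroup. -/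
noncomputable def orbit (S : MarkovSemigroup K) (x : K) (f : C(K, ℂ)) : S.Elem →ᵇ ℂ :=
  BoundedContinuousFunction.ofNormedAddCommGroup (fun U => U.1 f x)
    ((ContinuousEvalConst.continuous_eval_const x).comp
      ((continuous_apply f).comp continuous_induced_dom)) ‖f‖
    fun U => norm_map_apply_le (S.markov U.1 U.2) f x

/-- The state is the invariant mean of U ↦ (Ug)(x), with x in the zero set of I. It kills moduli of
elements of I because I is invariant and vanishes at x. -/
theorem nonempty_invariantStates {S : MarkovSemigroup K} (hS : S.RightAmenable)
    {I : Ideal C(K, ℂ)} (hI : IsClosed (I : Set C(K, ℂ))) (hproper : I ≠ ⊤)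
    (hinv : ∀ T ∈ S.ops, ∀ f ∈ I, T f ∈ I) : (S.invariantStates I).Nonempty := by
  obtain ⟨m, mpos, mone, minv⟩ := hS
  obtain ⟨x, hx⟩ : ∃ x, x ∉ ContinuousMap.setOfIdeal I := by
    by_contra! hcon
    refine hproper (eq_top_iff.2 fun f _ => mem_of_eq_zero hI fun x hx => (hx (hcon x)).elim)
  rw [ContinuousMap.notMem_setOfIdeal] at hx
  let φ₀ : C(K, ℝ) →ₗ[ℝ] ℝ :=
    { toFun := fun g => (m (S.orbit x (complexify g))).re
      map_add' := fun f g => by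
        rw [← Complex.add_re, ← map_add]
        congr 2
        ext U
        have : complexify (f + g) = complexify f + complexify g := by ext x; simp [complexify]
        simp [orbit, this]
      map_smul' := fun c g => by
        have h1 : S.orbit x (complexify (c • g)) = (c : ℂ) • S.orbit x (complexify g) := by
          ext U
          have : complexify (c • g) = (c : ℂ) • complexify g := by ext x; simp [complexify]
          simp [orbit, this]
        rw [h1, map_smul]
        simp }
  let φ : StrongDual ℝ C(K, ℝ) := φ₀.mkContinuous ‖m‖ fun g => by
    refine (Complex.abs_re_le_norm _).trans ((m.le_opNorm _).trans ?_)
    refine mul_le_mul_of_nonneg_left ?_ (norm_nonneg _)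
    refine (BoundedContinuousFunction.norm_le (norm_nonneg g)).2 fun U => ?_
    refine (norm_map_apply_le (S.markov U.1 U.2) _ x).trans ?_
    refine (ContinuousMap.norm_le _ (norm_nonneg _)).2 fun y => ?_
    simpa [complexify] using g.norm_coe_le_norm y
  refine ⟨StrongDual.toWeakDual φ, fun g hg => ?_, ?_, fun T hT g => ?_, fun f hf => ?_⟩
  · change 0 ≤ (m (S.orbit x (complexify g))).re
    exact (Complex.le_def.1 (mpos _ fun U => (S.markov U.1 U.2).nonneg _
      (fun y => Complex.zero_le_real.2 (hg y)) x)).1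
  · change (m (S.orbit x (complexify 1))).re = 1
    have : S.orbit x (complexify 1) = BoundedContinuousFunction.const S.Elem 1 := by
      ext U
      have h1 : complexify (1 : C(K, ℝ)) = 1 := by ext x; simp [complexify]
      have h2 := (S.markov U.1 U.2).map_one
      simp [orbit, h1, h2]
    rw [this, mone, Complex.one_re]
  · change (m (S.orbit x (complexify (realOp T g)))).re = (m (S.orbit x (complexify g))).re
    -- The orbit function of Tg is the right translate by T of that of g.
    rw [complexify_realOp (S.markov T hT), ← minv ⟨T, hT⟩ (S.orbit x (complexify g))]
    rfl
  · change (m (S.orbit x (complexify (normMap f)))).re = 0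
    have : S.orbit x (complexify (normMap f)) = 0 := by
      ext U
      have hmod : modulus f ∈ I := mem_of_eq_zero hI fun y hy => by
        simp [modulus, ContinuousMap.notMem_setOfIdeal.1 hy hf]
      exact hx (hinv U.1 U.2 _ hmod)
    rw [this, map_zero, Complex.zero_re]

end Functionals

end MarkovSemigroup

/-! ### Extreme invariant states and ergodic measures -/

namespace MarkovSemigroup

variable {K : Type*} [TopologicalSpace K] [CompactSpace K] [T2Space K] [MeasurableSpace K]
  [BorelSpace K]

theorem integrable_mul_cont {μ : ProbabilityMeasure K} {w : K → ℝ}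
    (hw : Integrable w (μ : Measure K)) (g : C(K, ℝ)) :
    Integrable (fun x => w x * g x) (μ : Measure K) :=
  hw.mul_bdd (c := ‖g‖) g.continuous.aestronglyMeasurable (.of_forall g.norm_coe_le_norm)

/-- Extreme invariant states admit only trivial perturbations by bounded invariant densities. -/
theorem integral_mul_eq_zero_of_extreme {S : MarkovSemigroup K} {I : Ideal C(K, ℂ)}
    {φ : WeakDual ℝ C(K, ℝ)} (hφ : φ ∈ extremePoints ℝ (S.invariantStates I))
    {μ : ProbabilityMeasure K} (hμ : ∀ g : C(K, ℝ), ∫ x, g x ∂(μ : Measure K) = φ g)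
    {w : K → ℝ} (hw : Integrable w (μ : Measure K)) (hw1 : ∀ x, |w x| ≤ 1)
    (hw0 : ∫ x, w x ∂(μ : Measure K) = 0)
    (hinv : ∀ T ∈ S.ops, ∀ g : C(K, ℝ),
      ∫ x, w x * realOp T g x ∂(μ : Measure K) = ∫ x, w x * g x ∂(μ : Measure K))
    (g : C(K, ℝ)) : ∫ x, w x * g x ∂(μ : Measure K) = 0 := by
  have hi := fun g => integrable_mul_cont hw g
  let ψ₀ : C(K, ℝ) →ₗ[ℝ] ℝ :=
    { toFun := fun g => ∫ x, w x * g x ∂(μ : Measure K)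
      map_add' := fun f g => by
        rw [← integral_add (hi f) (hi g)]
        simp [mul_add]
      map_smul' := fun c g => by
        rw [RingHom.id_apply, smul_eq_mul, ← integral_const_mul]
        simp only [ContinuousMap.smul_apply, smul_eq_mul]
        exact integral_congr_ae (.of_forall fun x => by ring) }
  have hle : ∀ f : C(K, ℝ), |ψ₀ f| ≤ ∫ x, |f x| ∂(μ : Measure K) := fun f => by
    refine abs_integral_le_integral_abs.trans (integral_mono (hi f).abs
      (integrable_cont μ |f|) fun x => ?_)
    dsimp only
    rw [abs_mul]
    exact mul_le_of_le_one_left (abs_nonneg _) (hw1 x)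
  let ψ : StrongDual ℝ C(K, ℝ) := ψ₀.mkContinuous 1 fun f => by
    refine (hle f).trans ?_
    have := integral_mono (integrable_cont μ |f|) (integrable_const ‖f‖ (μ := (μ : Measure K)))
      fun x => f.norm_coe_le_norm x
    simpa using this
  have hψ : ∀ f, (StrongDual.toWeakDual ψ) f = ψ₀ f := fun _ => rfl
  obtain ⟨⟨hpos, hone, hfix, hI⟩, hext⟩ := mem_extremePoints.1 hφ
  -- As |w| ≤ 1, the functional ψ is dominated by φ on nonnegative functions. So φ ± ψ are positive
  -- and still vanish on the moduli from I; their midpoint is φ.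
  have key : ∀ s : ℝ, |s| = 1 → φ + s • StrongDual.toWeakDual ψ ∈ S.invariantStates I := by
    intro s hs
    have happ : ∀ f, (φ + s • StrongDual.toWeakDual ψ) f = φ f + s * ψ₀ f := fun _ => rfl
    have hbd : ∀ f : C(K, ℝ), 0 ≤ f → |s * ψ₀ f| ≤ φ f := fun f hf => by
      rw [abs_mul, hs, one_mul, ← hμ]
      refine (hle f).trans (le_of_eq (integral_congr_ae (.of_forall fun x => ?_)))
      exact abs_of_nonneg (hf x)
    refine ⟨fun f hf => ?_, ?_, fun T hT f => ?_, fun f hf => ?_⟩ <;> rw [happ]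
    · linarith [(abs_le.1 (hbd f hf)).1]
    · have : ψ₀ 1 = 0 := by simpa [ψ₀] using hw0
      rw [hone, this, mul_zero, add_zero]
    · rw [happ, hfix T hT]
      exact congrArg (fun r => φ f + s * r) (hinv T hT f)
    · have h1 := hbd (normMap f) fun x => norm_nonneg _
      rw [hI f hf] at h1 ⊢
      rw [abs_nonpos_iff.1 h1, add_zero]
  have h1 := (hext _ (key 1 (by simp)) _ (key (-1) (by simp))
    ⟨1 / 2, 1 / 2, by norm_num, by norm_num, by norm_num, by module⟩).1
  have h2 := congrArg (fun θ : WeakDual ℝ C(K, ℝ) => θ g) h1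
  change φ g + 1 * ψ₀ g = φ g at h2
  change ψ₀ g = 0
  linarith

/-- With respect to an extreme invariant state, `L¹`-functions that are almost fixed under each
operator of the semigroup are constant. -/
theorem ae_const_of_extreme {S : MarkovSemigroup K} {I : Ideal C(K, ℂ)}
    {φ : WeakDual ℝ C(K, ℝ)} (hφ : φ ∈ extremePoints ℝ (S.invariantStates I))
    {μ : ProbabilityMeasure K} [(μ : Measure K).Regular]
    (hμ : ∀ g : C(K, ℝ), ∫ x, g x ∂(μ : Measure K) = φ g)
    {h : K → ℝ} (hh : Integrable h (μ : Measure K))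
    (happ : ∀ T ∈ S.ops, ∀ ε > 0, ∃ f : C(K, ℝ), ∫ x, |f x - h x| ∂(μ : Measure K) ≤ ε ∧
      ∫ x, |realOp T f x - f x| ∂(μ : Measure K) ≤ ε) :
    ∃ c, h =ᵐ[(μ : Measure K)] fun _ => c := by
  have hpres : ∀ T ∈ S.ops, PreservesIntegral (realOp T) μ := fun T hT =>
    ⟨fun g => realOp_nonneg (S.markov T hT), realOp_one (S.markov T hT), fun g => by
      rw [hμ, hμ, (extremePoints_subset hφ).2.2.1 T hT]⟩
  have hclamp : ∀ N : ℝ, 0 < N →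
      (fun x => clamp N (h x)) =ᵐ[(μ : Measure K)]
        fun _ => ∫ x, clamp N (h x) ∂(μ : Measure K) := by
    intro N hN
    set a := ∫ x, clamp N (h x) ∂(μ : Measure K) with ha
    have hci : Integrable (fun x => clamp N (h x)) (μ : Measure K) :=
      Integrable.of_bound ((continuous_clamp N).comp_aestronglyMeasurable hh.1) N
        (.of_forall fun x => abs_clamp_le hN.le _)
    have haN : |a| ≤ N := by
      refine abs_integral_le_integral_abs.trans ?_
      have := integral_mono hci.abs (integrable_const N (μ := (μ : Measure K)))
        fun x => abs_clamp_le hN.le _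
      simpa using this
    -- The centred truncation has mean zero and is bounded by 2N, so this scaling is an admissible
    -- perturbation.
    have hwi : Integrable (fun x => (2 * N)⁻¹ * (clamp N (h x) - a)) (μ : Measure K) :=
      (hci.sub (integrable_const a)).const_mul _
    have hw1 : ∀ x, |(2 * N)⁻¹ * (clamp N (h x) - a)| ≤ 1 := fun x => by
      rw [abs_mul, abs_of_pos (by positivity : 0 < (2 * N)⁻¹), inv_mul_le_iff₀ (by positivity)]
      have := abs_sub (clamp N (h x)) a
      linarith [abs_clamp_le hN.le (h x)]
    have hcalc : ∀ g : C(K, ℝ), ∫ x, (2 * N)⁻¹ * (clamp N (h x) - a) * g x ∂(μ : Measure K)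
        = (2 * N)⁻¹ * (∫ x, clamp N (h x) * g x ∂(μ : Measure K)
          - a * ∫ x, g x ∂(μ : Measure K)) := fun g => by
      rw [← integral_const_mul a, ← integral_sub (integrable_mul_cont hci g)
        ((integrable_cont μ g).const_mul a), ← integral_const_mul]
      exact integral_congr_ae (.of_forall fun x => by ring)
    have hz := integral_mul_eq_zero_of_extreme hφ hμ hwi hw1 (by
        have := hcalc 1
        simpa [← ha] using this)
      fun T hT g => by
        rw [hcalc, hcalc, (hpres T hT).integral_map,
          (hpres T hT).integral_clamp_mul_map hh (happ T hT) hN.le]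
    filter_upwards [ae_eq_zero_of_integral_mul_eq_zero hwi.1 hw1 hz] with x hx
    have h2 : (2 * N)⁻¹ ≠ 0 := by positivity
    exact sub_eq_zero.1 ((mul_eq_zero.1 hx).resolve_left h2)
  -- As h is finite everywhere, some level n + 1 (positive even for n = 0) strictly bounds |h| on a
  -- non-null set. There the truncation equals h, so its constant value is strictly inside the
  -- interval and no truncation occurs almost everywhere.
  obtain ⟨n, hn⟩ : ∃ n : ℕ, ∃ᵐ x ∂(μ : Measure K), |h x| < (n : ℝ) + 1 := by
    by_contra! hcon
    obtain ⟨x, hx⟩ := (ae_all_iff.2 hcon).exists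
    obtain ⟨n, hn⟩ := exists_nat_gt |h x|
    linarith [hx n]
  have hN : (0 : ℝ) < n + 1 := by positivity
  obtain ⟨x, hx, hxc⟩ := (hn.and_eventually (hclamp _ hN)).exists
  dsimp only at hxc
  rw [clamp_eq_self hx.le] at hxc
  refine ⟨h x, ?_⟩
  filter_upwards [hclamp _ hN] with y hy
  rw [← hxc] at hy
  rw [← hy, clamp_eq_self_of_abs_clamp_lt (by rwa [hy])]

theorem integral_map_eq_of_real {T : C(K, ℂ) →L[ℂ] C(K, ℂ)} (hT : IsMarkov T)
    {μ : ProbabilityMeasure K}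
    (h : ∀ g, ∫ x, realOp T g x ∂(μ : Measure K) = ∫ x, g x ∂(μ : Measure K)) (f : C(K, ℂ)) :
    ∫ x, T f x ∂(μ : Measure K) = ∫ x, f x ∂(μ : Measure K) := by
  have hre : ∀ f : C(K, ℂ), (∫ x, f x ∂(μ : Measure K)).re = ∫ x, rePart f x ∂(μ : Measure K) :=
    fun f => (integral_re (𝕜 := ℂ) (integrable_cont μ f)).symm
  have key : ∀ f : C(K, ℂ), (∫ x, T f x ∂(μ : Measure K)).re = (∫ x, f x ∂(μ : Measure K)).re :=
    fun f => by rw [hre, hre, rePart_map hT, h]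
  refine Complex.ext (key f) ?_
  have him : ∀ f : C(K, ℂ),
      ∫ x, (-Complex.I • f) x ∂(μ : Measure K) = -Complex.I * ∫ x, f x ∂(μ : Measure K) :=
    fun f => integral_const_mul _ _
  have := key (-Complex.I • f)
  rw [map_smul, him, him] at this
  simpa using this

/-- Elements of `fixL1` are limits of almost fixed continuous functions. -/
theorem exists_approx_of_mem_fixL1 {S : MarkovSemigroup K} {μ : ProbabilityMeasure K}
    (hμ : μ ∈ S.invariantMeasures) {h : Lp ℂ 1 (μ : Measure K)} (hh : h ∈ S.fixL1 μ)
    {T : C(K, ℂ) →L[ℂ] C(K, ℂ)} (hT : T ∈ S.ops) {ε : ℝ} (hε : 0 < ε) :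
    ∃ f : C(K, ℝ), ∫ x, |f x - (h x).re| ∂(μ : Measure K) ≤ ε ∧
      ∫ x, |realOp T f x - f x| ∂(μ : Measure K) ≤ ε := by
  -- This open set contains h because h is fixed, so it meets the dense image of C(K).
  have hopen : IsOpen {u : Lp ℂ 1 (μ : Measure K) | ‖u - h‖ < ε ∧ ‖inducedL1 T μ u - u‖ < ε} :=
    (isOpen_lt (f := fun u => ‖u - h‖) (by fun_prop) continuous_const).inter
      (isOpen_lt (f := fun u => ‖inducedL1 T μ u - u‖) (by fun_prop) continuous_const)
  obtain ⟨f, hf1, hf2⟩ := (denseRange_toL1 hμ).exists_mem_open hopen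
    ⟨h, by simpa using hε, by simpa [hh T hT] using hε⟩
  refine ⟨rePart f, ?_, ?_⟩
  · refine le_trans ?_ hf1.le
    rw [L1.norm_eq_integral_norm]
    refine integral_mono_of_nonneg (.of_forall fun x => abs_nonneg _)
      (L1.integrable_coeFn _).norm ?_
    filter_upwards [Lp.coeFn_sub (toL1 μ f) h,
      ContinuousMap.coeFn_toLp (p := 1) (𝕜 := ℂ) (μ : Measure K) f] with x hx1 hx2
    rw [hx1, Pi.sub_apply, toL1, hx2]
    exact (Complex.abs_re_le_norm _).trans' (by simp [rePart])
  · refine le_trans ?_ hf2.le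
    rw [inducedL1_toL1 hμ hT, ← map_sub, norm_toL1, ← rePart_map (S.markov T hT)]
    refine integral_mono (integrable_cont μ |rePart (T f) - rePart f|)
      (integrable_cont μ (T f - f)).norm fun x => ?_
    exact (Complex.abs_re_le_norm _).trans' (by simp [rePart])

theorem toL1_one_ne_zero (μ : ProbabilityMeasure K) : toL1 μ 1 ≠ 0 := by
  intro h0
  have := norm_toL1 μ 1
  rw [h0, norm_zero] at this
  simp at this

theorem toL1_one_mem_fixL1 {S : MarkovSemigroup K} {μ : ProbabilityMeasure K}
    (hμ : μ ∈ S.invariantMeasures) : toL1 μ 1 ∈ S.fixL1 μ := fun T hT => by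
  rw [inducedL1_toL1 hμ hT, (S.markov T hT).map_one]

/-- Extreme invariant states are represented by ergodic measures. -/
theorem exists_isErgodic_of_extreme {S : MarkovSemigroup K} {I : Ideal C(K, ℂ)}
    {φ : WeakDual ℝ C(K, ℝ)} (hφ : φ ∈ extremePoints ℝ (S.invariantStates I)) :
    ∃ μ, S.IsErgodic μ ∧ I ≤ absKernel μ := by
  obtain ⟨hpos, hone, hfix, hI⟩ := extremePoints_subset hφ
  obtain ⟨μ, hreg, hμ⟩ := exists_probabilityMeasure_integral_eq (φ : C(K, ℝ) →ₗ[ℝ] ℝ) hpos hone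
  have hinv : μ ∈ S.invariantMeasures := ⟨hreg, fun T hT f =>
    integral_map_eq_of_real (S.markov T hT)
      (fun g => (hμ _).trans ((hfix T hT g).trans (hμ g).symm)) f⟩
  refine ⟨μ, ⟨hinv, ?_⟩, fun f hf => (hμ (normMap f)).trans (hI f hf)⟩
  refine (finrank_eq_one_iff_of_nonzero' (⟨toL1 μ 1, toL1_one_mem_fixL1 hinv⟩ : S.fixL1 μ)
    fun h0 => toL1_one_ne_zero μ (congrArg Subtype.val h0)).2 ?_
  have hre : ∀ h ∈ S.fixL1 μ, ∃ c : ℝ, (fun x => (h x).re) =ᵐ[(μ : Measure K)] fun _ => c :=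
    fun h hh => ae_const_of_extreme hφ hμ (L1.integrable_coeFn h).re
      fun T hT ε hε => exists_approx_of_mem_fixL1 hinv hh hT hε
  rintro ⟨h, hh⟩
  obtain ⟨a, ha⟩ := hre h hh
  -- The real part of -ih is the imaginary part of h.
  obtain ⟨b, hb⟩ := hre _ ((S.fixL1 μ).smul_mem (-Complex.I) hh)
  refine ⟨⟨a, b⟩, Subtype.ext (Lp.ext ?_)⟩
  change ((⟨a, b⟩ : ℂ) • toL1 μ 1 : Lp ℂ 1 (μ : Measure K)) =ᵐ[(μ : Measure K)] h
  filter_upwards [ha, hb, Lp.coeFn_smul (⟨a, b⟩ : ℂ) (toL1 μ 1), Lp.coeFn_smul (-Complex.I) h,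
    ContinuousMap.coeFn_toLp (p := 1) (𝕜 := ℂ) (μ : Measure K) (1 : C(K, ℂ))]
    with x hxa hxb hx1 hx2 hx3
  rw [hx1, Pi.smul_apply, toL1, hx3]
  rw [hx2] at hxb
  refine Complex.ext ?_ ?_
  · simpa using hxa.symm
  · simpa using hxb.symm

/-- The ideal is the null space of the continuous seminorm f ↦ ‖`toL1 μ f`‖, which operators of the
semigroup do not increase and which is nonzero at 1. -/
theorem isSIdeal_absKernel {S : MarkovSemigroup K} {μ : ProbabilityMeasure K}
    (hμ : μ ∈ S.invariantMeasures) : S.IsSIdeal (absKernel μ) := by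
  have hmem : ∀ f, f ∈ absKernel μ ↔ ‖toL1 μ f‖ = 0 := fun f => by rw [norm_toL1]; rfl
  refine ⟨?_, fun h => ?_, fun T hT f hf => ?_⟩
  · have : (absKernel μ : Set C(K, ℂ)) = {f | ‖toL1 μ f‖ = 0} := Set.ext hmem
    rw [this]
    exact isClosed_eq (by fun_prop) continuous_const
  · have h1 : (1 : C(K, ℂ)) ∈ absKernel μ := h ▸ Submodule.mem_top
    exact toL1_one_ne_zero μ (norm_eq_zero.1 ((hmem 1).1 h1))
  · rw [hmem] at hf ⊢
    exact le_antisymm ((norm_toL1_map_le hμ hT f).trans hf.le) (norm_nonneg _)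

/-- Every proper invariant ideal is contained in a primitive ideal. -/
theorem exists_prim_ge {S : MarkovSemigroup K} (hS : S.RightAmenable) {I : Ideal C(K, ℂ)}
    (hI : I ≠ ⊤) (hinv : ∀ T ∈ S.ops, ∀ f ∈ I, T f ∈ I) :
    ∃ p : S.Prim, I ≤ (p : Ideal C(K, ℂ)) := by
  have hcl : (I.closure : Set C(K, ℂ)) = closure I := rfl
  -- The closure of a proper ideal stays proper, and it stays invariant by continuity of the
  -- operators.
  obtain ⟨φ, hφ⟩ := (S.isCompact_invariantStates I.closure).extremePoints_nonempty
    (nonempty_invariantStates hS (hcl ▸ isClosed_closure) (I.closure_ne_top hI)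
      fun T hT f hf => map_mem_closure T.continuous hf (hinv T hT))
  obtain ⟨μ, hμ, hle⟩ := exists_isErgodic_of_extreme hφ
  exact ⟨⟨absKernel μ, isSIdeal_absKernel hμ.1, μ, hμ, rfl⟩,
    fun f hf => hle (subset_closure hf)⟩

end MarkovSemigroup

/-! ### Fixed functions modulo primitive ideals -/

namespace MarkovSemigroup

variable {K : Type*} [TopologicalSpace K] [CompactSpace K] [T2Space K] [MeasurableSpace K]
  [BorelSpace K] {S : MarkovSemigroup K}

/-- Ergodicity makes the L¹ class of f a multiple of the class of 1; integration identifies the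
factor. -/
theorem sub_integral_mem_absKernel {μ : ProbabilityMeasure K} (hμ : S.IsErgodic μ) {f : C(K, ℂ)}
    (hf : f ∈ S.fix) : f - (∫ x, f x ∂(μ : Measure K)) • 1 ∈ absKernel μ := by
  have hfL : toL1 μ f ∈ S.fixL1 μ := fun T hT => by rw [inducedL1_toL1 hμ.1 hT, hf T hT]
  obtain ⟨c, hc⟩ := (finrank_eq_one_iff_of_nonzero'
    (⟨toL1 μ 1, toL1_one_mem_fixL1 hμ.1⟩ : S.fixL1 μ)
    (fun h0 => toL1_one_ne_zero μ (congrArg Subtype.val h0))).1 hμ.2 ⟨_, hfL⟩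
  replace hc : c • toL1 μ 1 = toL1 μ f := congrArg Subtype.val hc
  have h0 : ∫ x, ‖(f - c • (1 : C(K, ℂ))) x‖ ∂(μ : Measure K) = 0 := by
    rw [← norm_toL1, map_sub, map_smul, hc, sub_self, norm_zero]
  have h1 : ∫ x, (f - c • (1 : C(K, ℂ))) x ∂(μ : Measure K) = 0 :=
    norm_le_zero_iff.1 ((norm_integral_le_integral_norm _).trans h0.le)
  have h2 : ∫ x, f x ∂(μ : Measure K) = c := by
    simp only [ContinuousMap.sub_apply, ContinuousMap.smul_apply, ContinuousMap.one_apply] at h1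
    rw [integral_sub (integrable_cont μ f) (integrable_const _)] at h1
    simpa using sub_eq_zero.1 h1
  rw [h2]
  exact h0

theorem exists_sub_smul_one_mem {f : C(K, ℂ)} (hf : f ∈ S.fix) (p : S.Prim) :
    ∃ c : ℂ, f - c • 1 ∈ (p : Ideal C(K, ℂ)) := by
  obtain ⟨μ, hμ, hp⟩ := p.2.2
  exact ⟨_, hp ▸ sub_integral_mem_absKernel hμ hf⟩

/-- `setOfIdeal` is the complement of the zero set. Evaluation at a point of the zero set computes
transforms, so algebraic identities and positivity can be checked pointwise. -/
theorem exists_notMem_setOfIdeal (p : S.Prim) :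
    ∃ x, x ∉ ContinuousMap.setOfIdeal (p : Ideal C(K, ℂ)) := by
  by_contra! hcon
  exact p.2.1.proper (eq_top_iff.2 fun f _ =>
    mem_of_eq_zero p.2.1.isClosed fun x hx => (hx (hcon x)).elim)

theorem smul_one_mem_iff {p : S.Prim} {c : ℂ} :
    c • (1 : C(K, ℂ)) ∈ (p : Ideal C(K, ℂ)) ↔ c = 0 := by
  refine ⟨fun h => ?_, fun h => by simp [h]⟩
  obtain ⟨x, hx⟩ := exists_notMem_setOfIdeal p
  simpa using ContinuousMap.notMem_setOfIdeal.1 hx h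

/-- The constant value that a fixed function takes modulo a primitive ideal. -/
noncomputable def gelfandValue (f : S.fix) (p : S.Prim) : ℂ :=
  (exists_sub_smul_one_mem f.2 p).choose

theorem sub_gelfandValue_mem (f : S.fix) (p : S.Prim) :
    (f : C(K, ℂ)) - gelfandValue f p • 1 ∈ (p : Ideal C(K, ℂ)) :=
  (exists_sub_smul_one_mem f.2 p).choose_spec

/-- A primitive ideal contains no nonzero constant, so the value is unique. Hence the integral of a
fixed function depends on an ergodic measure only through its ideal. -/
theorem gelfandValue_eq {f : S.fix} {p : S.Prim} {c : ℂ}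
    (h : (f : C(K, ℂ)) - c • 1 ∈ (p : Ideal C(K, ℂ))) : gelfandValue f p = c := by
  have := (p : Ideal C(K, ℂ)).sub_mem h (sub_gelfandValue_mem f p)
  rw [sub_sub_sub_cancel_left, ← sub_smul, smul_one_mem_iff] at this
  exact sub_eq_zero.1 this

theorem apply_eq_gelfandValue (f : S.fix) {p : S.Prim} {x : K}
    (hx : x ∉ ContinuousMap.setOfIdeal (p : Ideal C(K, ℂ))) :
    (f : C(K, ℂ)) x = gelfandValue f p := by
  have := ContinuousMap.notMem_setOfIdeal.1 hx (sub_gelfandValue_mem f p)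
  simpa [sub_eq_zero] using this

/-- On the zero set of p the function f is constant, hence so is φ ∘ f, and a closed ideal contains
every function vanishing on its zero set. -/
theorem comp_sub_mem (φ : C(ℂ, ℂ)) (f : S.fix) (p : S.Prim) :
    φ.comp (f : C(K, ℂ)) - φ (gelfandValue f p) • 1 ∈ (p : Ideal C(K, ℂ)) :=
  mem_of_eq_zero p.2.1.isClosed fun x hx => by simp [apply_eq_gelfandValue f hx]

theorem comp_mem_iff (φ : C(ℂ, ℂ)) (f : S.fix) (p : S.Prim) :
    φ.comp (f : C(K, ℂ)) ∈ (p : Ideal C(K, ℂ)) ↔ φ (gelfandValue f p) = 0 := by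
  rw [← smul_one_mem_iff (p := p), ← sub_add_cancel (φ.comp (f : C(K, ℂ)))
    (φ (gelfandValue f p) • 1)]
  exact (p : Ideal C(K, ℂ)).add_mem_iff_right (comp_sub_mem φ f p)

theorem isOpen_notMem (g : C(K, ℂ)) : IsOpen {p : S.Prim | g ∉ (p : Ideal C(K, ℂ))} := by
  have : IsClosed {p : S.Prim | g ∈ (p : Ideal C(K, ℂ))} := by
    rw [S.isClosed_iff]
    refine Subset.antisymm (fun p hp => hp ?_) (S.subset_hull_ker _)
    simp only [ker, SetLike.mem_coe, Ideal.mem_iInf]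
    exact fun q hq => hq
  exact this.isOpen_compl

theorem continuous_gelfandValue (f : S.fix) : Continuous (gelfandValue f) := by
  refine continuous_iff_continuousAt.2 fun p => Metric.tendsto_nhds.2 fun ε hε => ?_
  -- The bump is nonzero exactly on the open ε-ball around the value at p, so the ideals omitting φ
  -- ∘ f form an open neighbourhood of p on which the value moves by less than ε.
  let φ : C(ℂ, ℂ) := ⟨fun z => ((max (ε - ‖z - gelfandValue f p‖) 0 : ℝ) : ℂ), by fun_prop⟩
  have hp : p ∈ {q : S.Prim | φ.comp (f : C(K, ℂ)) ∉ (q : Ideal C(K, ℂ))} := by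
    rw [mem_ofPred_eq, comp_mem_iff]
    simpa [φ] using hε
  filter_upwards [(isOpen_notMem _).mem_nhds hp] with q hq
  rw [comp_mem_iff] at hq
  simpa [φ, dist_eq_norm] using hq

/-! ### Radical freeness and the fixed space -/

theorem RadicalFree.eq_zero (hS : S.RadicalFree) {f : C(K, ℂ)}
    (hf : ∀ p : S.Prim, f ∈ (p : Ideal C(K, ℂ))) : f = 0 := by
  have : f ∈ S.rad ((⊥ : Ideal C(K, ℂ)) : Set C(K, ℂ)) := by
    simp only [rad, ker, Ideal.mem_iInf]
    exact fun p _ => hf p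
  rwa [hS, Ideal.mem_bot] at this

/-- If f is congruent to a constant modulo p, then Tf is congruent to the same constant, as p is
invariant and T fixes 1. So Tf - f lies in every primitive ideal. -/
theorem RadicalFree.mem_fix (hS : S.RadicalFree) {f : C(K, ℂ)}
    (hf : ∀ p : S.Prim, ∃ c : ℂ, f - c • 1 ∈ (p : Ideal C(K, ℂ))) : f ∈ S.fix := by
  intro T hT
  refine sub_eq_zero.1 (hS.eq_zero fun p => ?_)
  obtain ⟨c, hc⟩ := hf p
  have h1 := p.2.1.invariant T hT _ hc
  rw [map_sub, map_smul, (S.markov T hT).map_one] at h1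
  simpa using (p : Ideal C(K, ℂ)).sub_mem h1 hc

theorem RadicalFree.comp_mem_fix (hS : S.RadicalFree) (φ : C(ℂ, ℂ)) (f : S.fix) :
    φ.comp (f : C(K, ℂ)) ∈ S.fix :=
  hS.mem_fix fun p => ⟨_, comp_sub_mem φ f p⟩

theorem RadicalFree.isBanachSublattice_fix (hS : S.RadicalFree) : IsBanachSublattice S.fix where
  isClosed := by
    have : (S.fix : Set C(K, ℂ)) = {f | ∀ T ∈ S.ops, T f = f} := rfl
    rw [this]
    simp only [ofPred_forall]
    exact isClosed_iInter fun T => isClosed_iInter fun _ => isClosed_eq T.continuous continuous_id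
  conj_mem f hf := hS.comp_mem_fix ⟨star, continuous_star⟩ ⟨f, hf⟩
  modulus_mem f hf := hS.comp_mem_fix ⟨fun z => ((‖z‖ : ℝ) : ℂ), by fun_prop⟩ ⟨f, hf⟩

/-! ### Quasi-compactness, separation and density -/

/-- If closed sets have empty intersection, the sum of their kernels lies in no primitive ideal and
hence is everything. Then 1 lies in a finite subsum, and the corresponding finitely many sets
already have empty intersection. -/
theorem RightAmenable.compactSpace_prim (hS : S.RightAmenable) : CompactSpace S.Prim := by
  refine compactSpace_of_finite_subfamily_closed fun {ι} Z hZ hempty => ?_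
  have htop : (⨆ i, S.ker (Z i)) = ⊤ := by
    by_contra hne
    obtain ⟨p, hp⟩ := exists_prim_ge hS hne fun T hT f hf =>
      Submodule.iSup_induction (fun i => S.ker (Z i)) (motive := fun f => T f ∈ ⨆ i, S.ker (Z i))
        hf (fun i g hg => le_iSup (fun i => S.ker (Z i)) i (S.ker_invariant _ T hT g hg))
        (by rw [map_zero]; exact Submodule.zero_mem _)
        fun f g hf hg => by rw [map_add]; exact Submodule.add_mem _ hf hg
    have : p ∈ ⋂ i, Z i := mem_iInter.2 fun i => by
      rw [← (S.isClosed_iff _).1 (hZ i)]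
      exact (le_iSup (fun i => S.ker (Z i)) i).trans hp
    simp [hempty] at this
  obtain ⟨u, hu⟩ := Submodule.mem_iSup_iff_exists_finset.1
    (htop ▸ Submodule.mem_top : (1 : C(K, ℂ)) ∈ ⨆ i, S.ker (Z i))
  refine ⟨u, eq_empty_of_forall_notMem fun p hp => p.2.1.proper ?_⟩
  have hle : (⨆ i ∈ u, S.ker (Z i)) ≤ (p : Ideal C(K, ℂ)) :=
    iSup₂_le fun i hi => iInf₂_le p (mem_iInter₂.1 hp i hi)
  exact (Ideal.eq_top_iff_one _).2 (hle hu)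

/-- The zero sets of the kernels of two disjoint closed subsets of the primitive spectrum are
disjoint. -/
theorem RightAmenable.not_forall_apply_eq_zero (hS : S.RightAmenable) {A B : Set S.Prim}
    (hA : IsClosed A) (hB : IsClosed B) (hAB : Disjoint A B) {x : K}
    (hxA : ∀ g ∈ S.ker A, g x = 0) (hxB : ∀ g ∈ S.ker B, g x = 0) : False := by
  have hne : S.ker A ⊔ S.ker B ≠ ⊤ := fun htop => by
    obtain ⟨g, hg, k, hk, hgk⟩ := Submodule.mem_sup.1
      (htop ▸ Submodule.mem_top : (1 : C(K, ℂ)) ∈ S.ker A ⊔ S.ker B)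
    have := congrArg (fun f : C(K, ℂ) => f x) hgk
    simp [hxA g hg, hxB k hk] at this
  obtain ⟨p, hp⟩ := exists_prim_ge hS hne fun T hT f hf => by
    obtain ⟨g, hg, k, hk, rfl⟩ := Submodule.mem_sup.1 hf
    rw [map_add]
    exact Submodule.add_mem_sup (S.ker_invariant _ T hT g hg) (S.ker_invariant _ T hT k hk)
  have hpA : p ∈ S.hull (S.ker A) := le_sup_left.trans hp
  have hpB : p ∈ S.hull (S.ker B) := le_sup_right.trans hp
  rw [(S.isClosed_iff _).1 hA] at hpA
  rw [(S.isClosed_iff _).1 hB] at hpB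
  exact disjoint_left.1 hAB hpA hpB

/-- A Urysohn function vanishing on the closure of the union lies in every primitive ideal, hence is
zero. -/
theorem RadicalFree.dense_zeroSets (hS : S.RadicalFree) :
    Dense {x : K | ∃ p : S.Prim, x ∉ ContinuousMap.setOfIdeal (p : Ideal C(K, ℂ))} := by
  intro x
  by_contra hx
  obtain ⟨g, hg0, hg1, -⟩ := exists_continuous_zero_one_of_isClosed isClosed_closure
    (isClosed_singleton (x := x)) (disjoint_singleton_right.2 hx)
  have h0 : complexify g = 0 := hS.eq_zero fun p => mem_of_eq_zero p.2.1.isClosed fun y hy => by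
    have : g y = 0 := hg0 (subset_closure ⟨p, hy⟩)
    simp [complexify, this]
  have h1 : g x = 1 := hg1 rfl
  have := congrArg (fun f : C(K, ℂ) => f x) h0
  simp [complexify, h1] at this

/-! ### The representation on the primitive spectrum -/

/-- The preimage of F takes the value F(p) on the zero set of p. It is well defined on the dense
union of these sets and extends continuously to K because kernels of disjoint closed sets have
disjoint zero sets. -/
theorem exists_gelfandValue_eq (hS : S.RightAmenable) (hrad : S.RadicalFree) (F : C(S.Prim, ℂ)) :
    ∃ f : S.fix, ∀ p, gelfandValue f p = F p := by
  have := hS.compactSpace_prim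
  set D := {x : K | ∃ p : S.Prim, x ∉ ContinuousMap.setOfIdeal (p : Ideal C(K, ℂ))}
  have di := hrad.dense_zeroSets.isDenseInducing_val
  choose P hP using fun x : D => x.2
  -- Balls of a third of the distance around distinct values are disjoint, and so are their closed
  -- preimages under F.
  have hsep : ∀ {b c : ℂ}, b ≠ c → ∀ x : K,
      (∀ g ∈ S.ker (F ⁻¹' Metric.closedBall b (dist b c / 3)), g x = 0) →
      (∀ g ∈ S.ker (F ⁻¹' Metric.closedBall c (dist b c / 3)), g x = 0) → False := by
    intro b c hbc x
    have hd := dist_pos.2 hbc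
    exact hS.not_forall_apply_eq_zero (Metric.isClosed_closedBall.preimage F.continuous)
      (Metric.isClosed_closedBall.preimage F.continuous)
      ((Metric.closedBall_disjoint_closedBall (by linarith)).preimage F)
  -- The value does not depend on which ideal is chosen for x.
  have hval : ∀ (x : D) (p : S.Prim), (x : K) ∉ ContinuousMap.setOfIdeal (p : Ideal C(K, ℂ)) →
      F (P x) = F p := by
    intro x p hx
    by_contra hne
    have hmem : ∀ q : S.Prim, (x : K) ∉ ContinuousMap.setOfIdeal (q : Ideal C(K, ℂ)) →
        ∀ r, 0 ≤ r → ∀ g ∈ S.ker (F ⁻¹' Metric.closedBall (F q) r), g x = 0 := by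
      intro q hq r hr g hg
      refine ContinuousMap.notMem_setOfIdeal.1 hq ?_
      simp only [ker, Ideal.mem_iInf] at hg
      exact hg q (Metric.mem_closedBall_self hr)
    exact hsep hne x (hmem _ (hP x) _ (by positivity)) (hmem _ hx _ (by positivity))
  have hlim : ∀ a : K, ∃ b, Tendsto (fun x => F (P x)) (comap ((↑) : D → K) (𝓝 a)) (𝓝 b) := by
    intro a
    have hne : NeBot (comap ((↑) : D → K) (𝓝 a)) := di.comap_nhds_neBot a
    have hbdd : Metric.closedBall (0 : ℂ) ‖F‖ ∈
        map (fun x => F (P x)) (comap ((↑) : D → K) (𝓝 a)) :=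
      mem_map.2 (univ_mem' fun x => mem_closedBall_zero_iff.2 (F.norm_coe_le_norm _))
    obtain ⟨b, -, hb⟩ := (isCompact_closedBall (0 : ℂ) ‖F‖).exists_clusterPt
      (le_principal_iff.2 hbdd)
    -- If g(a) ≠ 0, then g has no zeros near a; but arbitrarily near a there are x with F(P x) in
    -- the ball, where g vanishes.
    have hker : ∀ b, MapClusterPt b (comap ((↑) : D → K) (𝓝 a)) (fun x => F (P x)) → ∀ r, 0 < r →
        ∀ g ∈ S.ker (F ⁻¹' Metric.closedBall b r), g a = 0 := by
      intro b hb r hr g hg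
      by_contra hga
      have h1 := mapClusterPt_iff_frequently.1 hb _ (Metric.closedBall_mem_nhds b hr)
      have h2 : ∀ᶠ x : D in comap (↑) (𝓝 a), g x ≠ 0 :=
        (g.continuous.continuousAt.eventually_ne hga).comap _
      obtain ⟨x, hx1, hx2⟩ := (h1.and_eventually h2).exists
      simp only [ker, Ideal.mem_iInf] at hg
      exact hx2 (ContinuousMap.notMem_setOfIdeal.1 (hP x) (hg _ hx1))
    -- In a compact ball, uniqueness of the cluster value gives convergence.
    refine ⟨b, (isCompact_closedBall (0 : ℂ) ‖F‖).le_nhds_of_unique_clusterPt hbdd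
      fun c _ hc => ?_⟩
    by_contra hcb
    have hd := dist_pos.2 hcb
    exact hsep hcb a (hker c hc _ (by positivity)) (hker b hb _ (by positivity))
  let f : C(K, ℂ) := ⟨di.extend fun x => F (P x), di.continuous_extend hlim⟩
  have hf : ∀ p : S.Prim, f - F p • 1 ∈ (p : Ideal C(K, ℂ)) := fun p =>
    mem_of_eq_zero p.2.1.isClosed fun x hx => by
      have h1 : f x = F (P ⟨x, p, hx⟩) := di.extend_eq' hlim ⟨x, p, hx⟩
      simp [h1, hval ⟨x, p, hx⟩ p hx]
  exact ⟨⟨f, hrad.mem_fix fun p => ⟨_, hf p⟩⟩, fun p => gelfandValue_eq (hf p)⟩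

/-- The canonical representation of the fixed space on the primitive spectrum. -/
noncomputable def gelfandMap (S : MarkovSemigroup K) : S.fix →ₗ[ℂ] C(S.Prim, ℂ) where
  toFun f := ⟨gelfandValue f, continuous_gelfandValue f⟩
  map_add' f g := by
    ext p
    obtain ⟨x, hx⟩ := exists_notMem_setOfIdeal p
    simp [← apply_eq_gelfandValue _ hx]
  map_smul' c f := by
    ext p
    obtain ⟨x, hx⟩ := exists_notMem_setOfIdeal p
    simp [← apply_eq_gelfandValue _ hx]

/-- The values of the transform are the values of f on the union of the zero sets, which is dense.
-/
theorem RadicalFree.norm_gelfandMap [CompactSpace S.Prim] (hS : S.RadicalFree) (f : S.fix) :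
    ‖S.gelfandMap f‖ = ‖f‖ := by
  refine le_antisymm ((ContinuousMap.norm_le _ (norm_nonneg _)).2 fun p => ?_)
    ((ContinuousMap.norm_le _ (norm_nonneg _)).2 fun x => ?_)
  · obtain ⟨x, hx⟩ := exists_notMem_setOfIdeal p
    change ‖gelfandValue f p‖ ≤ ‖(f : C(K, ℂ))‖
    rw [← apply_eq_gelfandValue f hx]
    exact (f : C(K, ℂ)).norm_coe_le_norm x
  · refine (isClosed_le (f := fun x => ‖(f : C(K, ℂ)) x‖) (by fun_prop)
      (continuous_const (y := ‖S.gelfandMap f‖))).closure_subset_iff.2 ?_ (hS.dense_zeroSets x)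
    rintro y ⟨p, hy⟩
    rw [mem_ofPred_eq, apply_eq_gelfandValue f hy]
    exact (S.gelfandMap f).norm_coe_le_norm p

end MarkovSemigroup

theorem theorem6p2 {K : Type*} [TopologicalSpace K] [CompactSpace K] [T2Space K]
    [MeasurableSpace K] [BorelSpace K] (S : MarkovSemigroup K)
    (hamen : S.RightAmenable) (hrad : S.RadicalFree) :
    ∃ hL : IsBanachSublattice S.fix, ∃ _ : CompactSpace S.Prim,
      ∃ Φ : S.fix ≃ₗᵢ[ℂ] C(S.Prim, ℂ),
        -- `Φ f` is the function sending `I_μ` to `∫ f dμ`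
        (∀ (f : S.fix) (p : S.Prim) (μ : ProbabilityMeasure K), S.IsErgodic μ →
          (p : Ideal C(K, ℂ)) = absKernel μ →
            Φ f p = ∫ x, (f : C(K, ℂ)) x ∂(μ : Measure K)) ∧
        -- `Φ` is Markov
        (∀ f : S.fix, (∀ x, 0 ≤ (f : C(K, ℂ)) x) → ∀ p, 0 ≤ Φ f p) ∧
        Φ ⟨1, S.one_mem_fix⟩ = 1 ∧
        -- `Φ` is a lattice homomorphism
        (∀ f : S.fix, Φ ⟨modulus f, hL.modulus_mem f f.2⟩ = modulus (Φ f)) := by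
  have hcomp := hamen.compactSpace_prim
  refine ⟨hrad.isBanachSublattice_fix, hcomp, LinearIsometryEquiv.ofSurjective
    ⟨S.gelfandMap, hrad.norm_gelfandMap⟩ fun F => ?_, fun f p μ hμ hp => ?_, fun f hf p => ?_, ?_,
    fun f => ?_⟩
  · obtain ⟨f, hf⟩ := MarkovSemigroup.exists_gelfandValue_eq hamen hrad F
    exact ⟨f, ContinuousMap.ext hf⟩
  · exact MarkovSemigroup.gelfandValue_eq (hp ▸ MarkovSemigroup.sub_integral_mem_absKernel hμ f.2)
  · change 0 ≤ MarkovSemigroup.gelfandValue f p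
    obtain ⟨x, hx⟩ := MarkovSemigroup.exists_notMem_setOfIdeal p
    rw [← MarkovSemigroup.apply_eq_gelfandValue f hx]
    exact hf x
  · ext p
    exact MarkovSemigroup.gelfandValue_eq (by simp)
  · ext p
    change MarkovSemigroup.gelfandValue _ p = ((‖MarkovSemigroup.gelfandValue f p‖ : ℝ) : ℂ)
    obtain ⟨x, hx⟩ := MarkovSemigroup.exists_notMem_setOfIdeal p
    rw [← MarkovSemigroup.apply_eq_gelfandValue _ hx, ← MarkovSemigroup.apply_eq_gelfandValue f hx]
    rfl
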